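/- **Conventions.** All graphs are finite, simple and undirected. A cut-vertex of a graph $G$ is a vertex $u$ such that $G-u$ has more connected components than $G$. A graph is 2-connected if it is connected and has no cut-vertex; a block of $G$ is a maximal set of vertices inducing a 2-connected subgraph; $G$ is a block graph if each of its blocks is a clique. Let $G$ be a connected block graph, $V_{cut}(G)$ its set of cut-vertices, and $\mathcal B_u(G)$ the set of blocks of $G$ containing $u$. Let $\mathcal P_G$ be the set of all ordered pairs $(u,B)$ and $(B,u)$ with $u\in V_{cut}(G)$ and $B\in\mathcal B_u(G)$ (the arcs of the bidirected block-tree); $u$ is the base of both pairs. $G[u,B]$ is the subgraph of $G$ induced by the vertex set of the connected component containing $u$ of $G-\{uv\in E(G): v\in B\}$, and $G[B,u]$ is the subgraph induced by the vertex set of the connected component containing $u$ of $G-\{uv\in E(G): v\notin B\}$. Let $\beta_G(u,B)=\mathcal B_u(G[u,B])$ (the blocks of $G$ at $u$ other than $B$) and $\kappa_G(B,u)=B\cap V_{cut}(G[B,u])$ (the cut-vertices of $G$ in $B$ other than $u$). For an independent set $S$ of $G$ and $p\in\mathcal P_G$ let $S[p]=S\cap V(G[p])$. A $p$-independent set is an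 independent set of $G$ contained in $V(G[p])$; for such a set $Q$, let $\overline{Q}=Q\setminus\{u\}$, where $u$ is the base of $p$. The Boolean values $ua_G(p)$, $p\in\mathcal P_G$, are defined recursively: $ua_G(B,u)$ is true if $\kappa_G(B,u)=\emptyset$; if $\kappa_G(B,u)\neq\emptyset$, then $ua_G(B,u)$ is false exactly when $B=\kappa_G(B,u)\cup\{u\}$ and $ua_G(v,B)$ is true for all $v\in\kappa_G(B,u)$; and $ua_G(u,B)$ is true exactly when $ua_G(B',u)$ is true for some $B'\in\beta_G(u,B)$. In arithmetic expressions, true counts as $1$ and false as $0$. The capacity of a $p$-independent set $Q$ is defined recursively: if $p=(B,u)$, then $$cap(Q)=\sum_{v\in\kappa_G(B,u)}cap(Q[v,B])+ua_G(B,u)-|B\cap\overline{Q}|;$$ if $p=(u,B)$, then $cap(Q)=0$ if some $B'\in\beta_G(u,B)$ has $cap(Q[B',u])=0$ and $ua_G(B',u)=True$, and otherwise $$cap(Q)=\sum_{B'\in\beta_G(u,B)}\big(cap(Q[B',u])-ua_G(B',u)\big)+ua_G(u,B).$$ An independent set $C'$ of $G$ is reachable from an independent set $C$ if there are independent sets $C=C_0,C_1,\dots,C_k=C'$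 of $G$, $k\ge0$, such that each $C_{i+1}$ equals $C_i$ or arises from $C_i$ by replacing one vertex by a neighbour of it. The potential of $p\in\mathcal P_G$ with respect to an independent set $C$ is $$pot_G(C,p)=\max\big\{cap(C'[p])+|\overline{C'[p]}|-|\overline{C[p]}| : C' \text{ an independent set of } G \text{ reachable from } C\big\}.$$ **Statement.** Let $G$ be a connected block graph and $C$ an independent set of $G$. (i) For all $u\in V_{cut}(G)$ and $B\in\mathcal B_u(G)$, $$pot_G(C,(B,u))=\sum_{u'\in\kappa_G(B,u)}pot_G(C,(u',B))+ua_G(B,u)-|B\cap\overline{C[B,u]}|.$$ (ii) For all $u\in V_{cut}(G)$ and $B\in\mathcal B_u(G)$: if there are two distinct blocks $B',B''\in\mathcal B_u(G)$ with $pot_G(C,(B',u))=pot_G(C,(B'',u))=0$ and $ua_G(B',u)=ua_G(B'',u)=True$, then $pot_G(C,(u,B))=0$; otherwise $$pot_G(C,(u,B))=\sum_{B'\in\beta_G(u,B)}\big(pot_G(C,(B',u))-ua_G(B',u)\big)+ua_G(u,B).$$ (iii) For every $p\in\mathcal P_G$ there is an independent set $C'$ of $G$, reachable from $C$, such that $cap(C'[p])\ge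 pot_G(C,p)$ and $|\overline{C'[p]}|=|\overline{C[p]}|$. -/

import Mathlib

namespace TokenSliding

variable {V : Type*} [Fintype V] [DecidableEq V]

/-! Every graph below other than the ambient graph `G` is an induced subgraph `G[S]` of `G`, and is
represented by its vertex set `S`; the graph `G` itself is `G[V]`, that is `S = Finset.univ`. -/

/-- `v` is a cut-vertex of `G[S]`: it is a vertex of `G[S]`, and `G[S] - v` has more connected
components than `G[S]`. -/
def IsCutVertex (G : SimpleGraph V) (S : Finset V) (v : V) : Prop :=
  v ∈ S ∧
    Nat.card (G.induce (S : Set V)).ConnectedComponent <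
      Nat.card (G.induce ((S.erase v : Finset V) : Set V)).ConnectedComponent

/-- `G[T]` is 2-connected: it is connected and it has no cut-vertex. -/
def IsTwoConnected (G : SimpleGraph V) (T : Finset V) : Prop :=
  (G.induce (T : Set V)).Connected ∧ ∀ v, ¬ IsCutVertex G T v

/-- `B` is a block of `G[S]`: a maximal subset of `S` that induces a 2-connected graph. -/
def IsBlock (G : SimpleGraph V) (S B : Finset V) : Prop :=
  Maximal (fun T => T ⊆ S ∧ IsTwoConnected G T) B

/-- `G` is a connected block graph: it is connected and each block of it is a clique. -/
structure IsConnectedBlockGraph (G : SimpleGraph V) : Prop where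
  connected : G.Connected
  isClique : ∀ B, IsBlock G Finset.univ B → G.IsClique (B : Set V)

open scoped Classical in
/-- The set `V_cut(G[S])` of cut-vertices of `G[S]`. -/
noncomputable def cutVertices (G : SimpleGraph V) (S : Finset V) : Finset V :=
  Finset.univ.filter fun v => IsCutVertex G S v

open scoped Classical in
/-- The set `𝓑_u(G[S])` of the blocks of `G[S]` that contain `u`. -/
noncomputable def blocksAt (G : SimpleGraph V) (S : Finset V) (u : V) : Finset (Finset V) :=
  Finset.univ.filter fun B => IsBlock G S B ∧ u ∈ B

/-- A directed pair made of a vertex `u` and a vertex set `B`. -/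
inductive Arc (V : Type*) where
  /-- the pair `(u, B)` -/
  | vb (u : V) (B : Finset V) : Arc V
  /-- the pair `(B, u)` -/
  | bv (B : Finset V) (u : V) : Arc V

namespace Arc

/-- The base of an arc. -/
def base : Arc V → V
  | vb u _ => u
  | bv _ u => u

/-- The block of an arc. -/
def block : Arc V → Finset V
  | vb _ B => B
  | bv B _ => B

end Arc

/-- The set `𝓟_G` of the arcs `(u, B)`, `(B, u)` of the (bidirected) block-tree of `G`, where `u` is
a cut-vertex of `G` and `B` a block of `G` that contains `u`. -/
def arcs (G : SimpleGraph V) : Set (Arc V) :=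
  {p | p.base ∈ cutVertices G Finset.univ ∧ p.block ∈ blocksAt G Finset.univ p.base}

/-- The edges of `G` that are removed to obtain `G[p]`: the edges `uv` with `v ∈ B` for
`p = (u, B)`, and the edges `uv` with `v ∉ B` for `p = (B, u)`. -/
def cutEdges (G : SimpleGraph V) : Arc V → Set (Sym2 V)
  | .vb u B => {e ∈ G.edgeSet | ∃ v, v ∈ B ∧ e = s(u, v)}
  | .bv B u => {e ∈ G.edgeSet | ∃ v, v ∉ B ∧ e = s(u, v)}

open scoped Classical in
/-- The vertex set of `G[p]`, the connected component of the base of `p` after the removal of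
`cutEdges G p`. -/
noncomputable def verts (G : SimpleGraph V) (p : Arc V) : Finset V :=
  Finset.univ.filter fun x => (G.deleteEdges (cutEdges G p)).Reachable p.base x

/-- `κ_G(B, u)`: the cut-vertices of the graph `G[B, u]` that belong to `B`. -/
noncomputable def kappa (G : SimpleGraph V) (B : Finset V) (u : V) : Finset V :=
  B ∩ cutVertices G (verts G (.bv B u))

/-- `β_G(u, B)`: the blocks of the graph `G[u, B]` that contain `u`. -/
noncomputable def beta (G : SimpleGraph V) (u : V) (B : Finset V) : Finset (Finset V) :=
  blocksAt G (verts G (.vb u B)) u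

section WellFounded

/-! The two facts that make the recursions on the block-tree below terminate. -/

/-- A measure of an arc that decreases along the recursions. -/
noncomputable def size (G : SimpleGraph V) : Arc V → ℕ
  | .vb u B => 2 * (verts G (.vb u B)).card + 1
  | .bv B u => 2 * (verts G (.bv B u)).card

theorem not_isCutVertex_of_preconnected {G : SimpleGraph V} {S : Finset V} {v : V}
    (h : (G.induce ((S.erase v : Finset V) : Set V)).Preconnected) : ¬ IsCutVertex G S v := by
  rintro ⟨hv, hlt⟩
  have h1 := h.subsingleton_connectedComponent
  have h2 : Nat.card (G.induce ((S.erase v : Finset V) : Set V)).ConnectedComponent ≤ 1 :=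
    Finite.card_le_one_iff_subsingleton.2 h1
  have h3 : 0 < Nat.card (G.induce (S : Set V)).ConnectedComponent := by
    have : Nonempty (G.induce (S : Set V)).ConnectedComponent :=
      ⟨(G.induce (S : Set V)).connectedComponentMk ⟨v, hv⟩⟩
    exact Nat.card_pos
  omega

theorem base_mem_verts (G : SimpleGraph V) (p : Arc V) : p.base ∈ verts G p := by
  simp [verts]

theorem mem_verts_of_adj {G : SimpleGraph V} {p : Arc V} {x y : V} (hx : x ∈ verts G p)
    (h : G.Adj x y) (hc : s(x, y) ∉ cutEdges G p) : y ∈ verts G p := by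
  simp only [verts, Finset.mem_filter, Finset.mem_univ, true_and] at hx ⊢
  exact hx.trans (SimpleGraph.Adj.reachable (SimpleGraph.deleteEdges_adj.2 ⟨h, hc⟩))

/-- A set that contains the base and is closed under the remaining edges contains `G[p]`. -/
theorem verts_subset {G : SimpleGraph V} {p : Arc V} {S : Finset V} (hb : p.base ∈ S)
    (h : ∀ x ∈ S, x ∈ verts G p → ∀ y, G.Adj x y → s(x, y) ∉ cutEdges G p → y ∈ S) :
    verts G p ⊆ S := by
  intro z hz
  have hz' := hz
  simp only [verts, Finset.mem_filter, Finset.mem_univ, true_and] at hz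
  rw [SimpleGraph.reachable_iff_reflTransGen] at hz
  suffices z ∈ S ∧ z ∈ verts G p from this.1
  clear hz'
  induction hz with
  | refl => exact ⟨hb, base_mem_verts G p⟩
  | tail _ hyz ih =>
    obtain ⟨ha, hc⟩ := SimpleGraph.deleteEdges_adj.1 hyz
    exact ⟨h _ ih.1 ih.2 _ ha hc, mem_verts_of_adj ih.2 ha hc⟩

theorem size_lt_of_mem_beta {G : SimpleGraph V} {u : V} {B B' : Finset V}
    (h : B' ∈ beta G u B) : size G (.bv B' u) < size G (.vb u B) := by
  simp only [beta, blocksAt, Finset.mem_filter, Finset.mem_univ, true_and] at h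
  have hsub : B' ⊆ verts G (.vb u B) := h.1.prop.1
  have : verts G (.bv B' u) ⊆ verts G (.vb u B) := by
    refine verts_subset (base_mem_verts G (.vb u B)) fun x hx _ y hxy hc => ?_
    by_cases hxu : x = u
    · subst hxu
      apply hsub
      by_contra hy
      exact hc ⟨hxy, y, hy, rfl⟩
    · by_cases hyu : y = u
      · subst hyu
        exact base_mem_verts G (.vb y B)
      · refine mem_verts_of_adj hx hxy ?_
        rintro ⟨-, w, -, hw⟩
        rcases Sym2.eq_iff.1 hw with ⟨h1, -⟩ | ⟨-, h1⟩
        · exact hxu h1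
        · exact hyu h1
  have := Finset.card_le_card this
  simp only [size]
  omega

/-- In a graph all of whose blocks are cliques, `u` is not a cut-vertex of `G[B, u]`. -/
theorem not_isCutVertex_base {G : SimpleGraph V} {B : Finset V} {u : V}
    (hB : G.IsClique (B : Set V)) (hu : u ∈ B) :
    ¬ IsCutVertex G (verts G (.bv B u)) u := by
  apply not_isCutVertex_of_preconnected
  set S := verts G (.bv B u) with hS
  have huS : u ∈ S := base_mem_verts G (.bv B u)
  have hBS : ∀ b ∈ B, b ≠ u → b ∈ S := by
    intro b hb hbu
    refine mem_verts_of_adj huS (hB hu hb hbu.symm) ?_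
    rintro ⟨-, w, hw, hw'⟩
    rcases Sym2.eq_iff.1 hw' with ⟨-, h1⟩ | ⟨-, h1⟩
    · exact hw (h1 ▸ hb)
    · exact hbu h1
  let R : V → V → Prop := fun x y => ∃ (hx : x ∈ ((S.erase u : Finset V) : Set V))
    (hy : y ∈ ((S.erase u : Finset V) : Set V)),
    (G.induce ((S.erase u : Finset V) : Set V)).Reachable ⟨x, hx⟩ ⟨y, hy⟩
  have key : ∀ x ∈ S, x ≠ u → ∃ b ∈ B, b ≠ u ∧ R b x := by
    classical
    let S' : Finset V := S.filter fun x => x ≠ u → ∃ b ∈ B, b ≠ u ∧ R b x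
    have hsub : S ⊆ S' := by
      refine verts_subset (p := .bv B u) (S := S') ?_ ?_
      · simp only [S', Finset.mem_filter]
        exact ⟨huS, fun h => absurd rfl h⟩
      · intro x hx _ y hxy hc
        simp only [S', Finset.mem_filter] at hx ⊢
        have hyS : y ∈ S := mem_verts_of_adj hx.1 hxy hc
        refine ⟨hyS, fun hyu => ?_⟩
        have hy' : y ∈ ((S.erase u : Finset V) : Set V) := by simp [hyu, hyS]
        by_cases hxu : x = u
        · subst hxu
          have hyB : y ∈ B := by
            by_contra hy
            exact hc ⟨hxy, y, hy, rfl⟩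
          exact ⟨y, hyB, hyu, hy', hy', SimpleGraph.Reachable.refl _⟩
        · obtain ⟨b, hb, hbu, hb', hx', hr⟩ := hx.2 hxu
          refine ⟨b, hb, hbu, hb', hy', hr.trans ?_⟩
          exact SimpleGraph.Adj.reachable (SimpleGraph.induce_adj.2 hxy)
    intro x hx
    exact (Finset.mem_filter.1 (hsub hx)).2
  rintro ⟨x, hx⟩ ⟨y, hy⟩
  have hx1 : x ≠ u ∧ x ∈ S := Finset.mem_erase.1 hx
  have hy1 : y ≠ u ∧ y ∈ S := Finset.mem_erase.1 hy
  obtain ⟨b, hb, hbu, hb', hx', hr⟩ := key x hx1.2 hx1.1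
  obtain ⟨c, hcB, hcu, hc', hy', hr'⟩ := key y hy1.2 hy1.1
  refine hr.symm.trans (SimpleGraph.Reachable.trans ?_ hr')
  by_cases hbc : b = c
  · subst hbc
    exact SimpleGraph.Reachable.refl _
  · exact SimpleGraph.Adj.reachable (SimpleGraph.induce_adj.2 (hB hb hcB hbc))

/-- If a block `B` is a clique, then no other vertex of `B` belongs to `G[v, B]`. -/
theorem not_mem_verts_of_mem_block {G : SimpleGraph V} {B : Finset V} {u v : V}
    (hB : IsBlock G Finset.univ B) (hc : G.IsClique (B : Set V)) (hu : u ∈ B) (hv : v ∈ B)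
    (huv : u ≠ v) : u ∉ verts G (.vb v B) := by
  intro hmem
  simp only [verts, Finset.mem_filter, Finset.mem_univ, true_and] at hmem
  have hmem : (G.deleteEdges (cutEdges G (.vb v B))).Reachable v u := hmem
  obtain ⟨q, hq⟩ := hmem.exists_isPath
  have hle : G.deleteEdges (cutEdges G (.vb v B)) ≤ G := SimpleGraph.deleteEdges_le _
  let P := q.mapLe hle
  have hP : P.IsPath := hq.mapLe hle
  let T : Finset V := B ∪ P.support.toFinset
  have hjoin : ∀ w (x y : V) (hx : x ∈ ((T.erase w : Finset V) : Set V))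
      (hy : y ∈ ((T.erase w : Finset V) : Set V)) (W : G.Walk x y),
      (∀ z ∈ W.support, z ∈ T ∧ z ≠ w) →
      (G.induce ((T.erase w : Finset V) : Set V)).Reachable ⟨x, hx⟩ ⟨y, hy⟩ := by
    intro w x y hx hy W hW
    exact ⟨W.induce _ fun z hz => by simpa [and_comm] using hW z hz⟩
  have hBT : ∀ b ∈ B, b ∈ T := fun b hb => Finset.mem_union_left _ hb
  have hPT : ∀ b ∈ P.support, b ∈ T := fun b hb =>
    Finset.mem_union_right _ (List.mem_toFinset.2 hb)
  have hcon : ∀ w, (G.induce ((T.erase w : Finset V) : Set V)).Preconnected := by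
    intro w
    have key : ∀ x (hx : x ∈ ((T.erase w : Finset V) : Set V)), ∃ b ∈ B,
        ∃ hb : b ∈ ((T.erase w : Finset V) : Set V),
        (G.induce ((T.erase w : Finset V) : Set V)).Reachable ⟨x, hx⟩ ⟨b, hb⟩ := by
      intro x hx
      have hx' : x ≠ w ∧ x ∈ T := Finset.mem_erase.1 hx
      by_cases hxB : x ∈ B
      · exact ⟨x, hxB, hx, SimpleGraph.Reachable.refl _⟩
      have hxP : x ∈ P.support := by
        rcases Finset.mem_union.1 hx'.2 with h | h
        · exact absurd h hxB
        · exact List.mem_toFinset.1 h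
      by_cases hw : w ∈ (P.takeUntil x hxP).support
      · have hw2 : w ∉ (P.dropUntil x hxP).support := by
          intro hw2
          have hnd := hP.support_nodup
          rw [← P.take_spec hxP, SimpleGraph.Walk.support_append, List.nodup_append] at hnd
          have : w ∈ (P.dropUntil x hxP).support.tail := by
            rw [SimpleGraph.Walk.mem_support_iff] at hw2
            exact hw2.resolve_left hx'.1.symm
          exact hnd.2.2 w hw w this rfl
        have huw : u ≠ w := by
          rintro rfl
          exact hw2 (SimpleGraph.Walk.end_mem_support _)
        refine ⟨u, hu, by simp [huw, hBT u hu], hjoin w _ _ _ _ (P.dropUntil x hxP) ?_⟩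
        intro z hz
        refine ⟨hPT z (P.support_dropUntil_subset_support hxP hz), ?_⟩
        rintro rfl
        exact hw2 hz
      · have hvw : v ≠ w := by
          rintro rfl
          exact hw (SimpleGraph.Walk.start_mem_support _)
        refine ⟨v, hv, by simp [hvw, hBT v hv], hjoin w _ _ _ _ (P.takeUntil x hxP).reverse ?_⟩
        intro z hz
        rw [SimpleGraph.Walk.support_reverse, List.mem_reverse] at hz
        refine ⟨hPT z (P.support_takeUntil_subset_support hxP hz), ?_⟩
        rintro rfl
        exact hw hz
    rintro ⟨x, hx⟩ ⟨y, hy⟩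
    obtain ⟨b, hb, hb', hr⟩ := key x hx
    obtain ⟨c, hcB, hc', hr'⟩ := key y hy
    refine hr.trans (SimpleGraph.Reachable.trans ?_ hr'.symm)
    by_cases hbc : b = c
    · subst hbc
      exact SimpleGraph.Reachable.refl _
    · exact SimpleGraph.Adj.reachable (SimpleGraph.induce_adj.2 (hc hb hcB hbc))
  have hT : IsTwoConnected G T := by
    refine ⟨?_, fun w => not_isCutVertex_of_preconnected (hcon w)⟩
    have : Nonempty ((T : Finset V) : Set V) := ⟨⟨v, hBT v hv⟩⟩
    refine ⟨?_⟩
    have hvert : ∀ x (hx : x ∈ (T : Set V)),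
        (G.induce (T : Set V)).Reachable ⟨v, hBT v hv⟩ ⟨x, hx⟩ := by
      intro x hx
      by_cases hxB : x ∈ B
      · by_cases hvx : v = x
        · subst hvx
          exact SimpleGraph.Reachable.refl _
        · exact SimpleGraph.Adj.reachable (SimpleGraph.induce_adj.2 (hc hv hxB hvx))
      · have hxP : x ∈ P.support := by
          rcases Finset.mem_union.1 hx with h | h
          · exact absurd h hxB
          · exact List.mem_toFinset.1 h
        exact ⟨(P.takeUntil x hxP).induce _ fun z hz =>
          hPT z (P.support_takeUntil_subset_support hxP hz)⟩
    rintro ⟨x, hx⟩ ⟨y, hy⟩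
    exact (hvert x hx).symm.trans (hvert y hy)
  have hTB : T ⊆ B := hB.2 ⟨Finset.subset_univ _, hT⟩ Finset.subset_union_left
  have hsup : q.support = P.support := (SimpleGraph.Walk.support_mapLe_eq_support _ _).symm
  clear_value P
  cases q with
  | nil => exact huv rfl
  | @cons _ x _ hadj q' =>
    obtain ⟨ha, hcut⟩ := SimpleGraph.deleteEdges_adj.1 hadj
    have hxP : x ∈ P.support := by rw [← hsup]; simp
    exact hcut ⟨ha, x, hTB (hPT x hxP), rfl⟩

theorem size_lt_of_mem_kappa {G : SimpleGraph V} (hG : IsConnectedBlockGraph G) {B : Finset V}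
    {u v : V} (hB : Arc.bv B u ∈ arcs G) (h : v ∈ kappa G B u) :
    size G (.vb v B) < size G (.bv B u) := by
  have hB' : IsBlock G Finset.univ B ∧ u ∈ B := by
    have := hB.2
    simp only [blocksAt, Finset.mem_filter, Finset.mem_univ, true_and] at this
    exact this
  have hc := hG.isClique B hB'.1
  simp only [kappa, cutVertices, Finset.mem_inter, Finset.mem_filter, Finset.mem_univ,
    true_and] at h
  have huv : u ≠ v := by
    rintro rfl
    exact not_isCutVertex_base hc hB'.2 h.2
  have hnot := not_mem_verts_of_mem_block hB'.1 hc hB'.2 h.1 huv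
  have hsub : verts G (.vb v B) ⊆ verts G (.bv B u) := by
    refine verts_subset h.2.1 fun x hx hx' y hxy _ => ?_
    by_cases hyu : y = u
    · subst hyu
      exact base_mem_verts G (.bv B y)
    · refine mem_verts_of_adj hx hxy ?_
      rintro ⟨-, w, -, hw⟩
      rcases Sym2.eq_iff.1 hw with ⟨h1, -⟩ | ⟨-, h1⟩
      · exact hnot (h1 ▸ hx')
      · exact hyu h1
  have hlt : (verts G (.vb v B)).card < (verts G (.bv B u)).card :=
    Finset.card_lt_card ((Finset.ssubset_iff_of_subset hsub).2
      ⟨u, base_mem_verts G (.bv B u), hnot⟩)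
  simp only [size]
  omega

end WellFounded

/-- `ua_G(p)`, by recursion on the block-tree. The depth of `p` is `0` exactly when `p = (B, u)` and
`κ_G(B, u) = ∅`. (The values at pairs that are not arcs are irrelevant.) -/
def ua {G : SimpleGraph V} (hG : IsConnectedBlockGraph G) : Arc V → Prop
  | .bv B u => ∃ _hp : Arc.bv B u ∈ arcs G,
      kappa G B u = ∅ ∨
        ¬ ((∀ v, ∀ _hv : v ∈ kappa G B u, ua hG (.vb v B)) ∧ B = kappa G B u ∪ {u})
  | .vb u B => ∃ B', ∃ _hB' : B' ∈ beta G u B, ua hG (.bv B' u)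
termination_by p => size G p
decreasing_by
  · exact size_lt_of_mem_kappa hG _hp _hv
  · exact size_lt_of_mem_beta _hB'

open scoped Classical in
/-- The value of `ua_G(p)` in arithmetic expressions: `1` for true and `0` for false. -/
noncomputable def uaInt {G : SimpleGraph V} (hG : IsConnectedBlockGraph G) (p : Arc V) : ℤ :=
  if ua hG p then 1 else 0

/-- `C[p] = V(G[p]) ∩ C`. -/
noncomputable def restrict (G : SimpleGraph V) (C : Finset V) (p : Arc V) : Finset V :=
  verts G p ∩ C

/-- The interior of a `p`-independent set: the set without the base of `p`. -/
def interiorOf (p : Arc V) (C : Finset V) : Finset V :=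
  C.erase p.base

open scoped Classical in
/-- The capacity `cap(C)` of a `p`-independent set `C`, by recursion on the block-tree. (The values at
pairs that are not arcs are irrelevant.) -/
noncomputable def cap {G : SimpleGraph V} (hG : IsConnectedBlockGraph G) :
    Arc V → Finset V → ℤ
  | .bv B u, C =>
      if _hp : Arc.bv B u ∈ arcs G then
        (∑ v : {v // v ∈ kappa G B u}, cap hG (.vb v.1 B) (restrict G C (.vb v.1 B))) +
          uaInt hG (.bv B u) - ((B ∩ interiorOf (.bv B u) C).card : ℤ)
      else 0
  | .vb u B, C =>
      if ∃ B' : {B' // B' ∈ beta G u B},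
          cap hG (.bv B'.1 u) (restrict G C (.bv B'.1 u)) = 0 ∧ ua hG (.bv B'.1 u) then 0
      else
        (∑ B' : {B' // B' ∈ beta G u B},
          (cap hG (.bv B'.1 u) (restrict G C (.bv B'.1 u)) - uaInt hG (.bv B'.1 u))) +
          uaInt hG (.vb u B)
termination_by p => size G p
decreasing_by
  · exact size_lt_of_mem_kappa hG _hp v.2
  all_goals exact size_lt_of_mem_beta (Subtype.prop _)

/-- `I₁ → I₂` for independent sets of `G`: they are equal, or one token slides along an edge. -/
def Step (G : SimpleGraph V) (I₁ I₂ : Finset V) : Prop :=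
  G.IsIndepSet (I₁ : Set V) ∧ G.IsIndepSet (I₂ : Set V) ∧
    (I₁ = I₂ ∨ ∃ v₁ v₂, I₁ \ I₂ = {v₁} ∧ I₂ \ I₁ = {v₂} ∧ G.Adj v₁ v₂)

/-- `I'` is an independent set of `G` that is reachable from the independent set `I`. -/
def IsReachableFrom (G : SimpleGraph V) (I' I : Finset V) : Prop :=
  G.IsIndepSet (I : Set V) ∧ G.IsIndepSet (I' : Set V) ∧ Relation.ReflTransGen (Step G) I I'

/-- The set of the values `cap(C'[p]) + |int C'[p]| - |int C[p]|`, for the independent sets `C'` that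
are reachable from `C`. -/
def potValues {G : SimpleGraph V} (hG : IsConnectedBlockGraph G) (C : Finset V) (p : Arc V) :
    Set ℤ :=
  {x | ∃ C', IsReachableFrom G C' C ∧
    x = cap hG p (restrict G C' p) + ((interiorOf p (restrict G C' p)).card : ℤ) -
      ((interiorOf p (restrict G C p)).card : ℤ)}

/-- The potential `pot_G(C, p)`: the maximum of the finite set `potValues`. -/
noncomputable def pot {G : SimpleGraph V} (hG : IsConnectedBlockGraph G) (C : Finset V)
    (p : Arc V) : ℤ :=
  sSup (potValues hG C p)

/-- The supremum in the definition of the potential is a maximum. -/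
theorem pot_isGreatest {G : SimpleGraph V} (hG : IsConnectedBlockGraph G) {C : Finset V}
    (hC : G.IsIndepSet (C : Set V)) (p : Arc V) : IsGreatest (potValues hG C p) (pot hG C p) := by
  have hne : (potValues hG C p).Nonempty := ⟨_, C, ⟨hC, hC, .refl⟩, rfl⟩
  have hfin : (potValues hG C p).Finite := by
    refine (Set.finite_range fun C' : Finset V => cap hG p (restrict G C' p) +
      ((interiorOf p (restrict G C' p)).card : ℤ) - ((interiorOf p (restrict G C p)).card : ℤ)).subset ?_
    rintro x ⟨C', -, rfl⟩
    exact ⟨C', rfl⟩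
  exact ⟨Int.csSup_mem hne hfin.bddAbove, fun x hx => le_csSup hfin.bddAbove hx⟩

/-! The recursive equations of `ua` and `cap` at the arcs of the block-tree. -/

theorem ua_bv {G : SimpleGraph V} (hG : IsConnectedBlockGraph G) {B : Finset V} {u : V}
    (hp : Arc.bv B u ∈ arcs G) :
    ua hG (.bv B u) ↔ (kappa G B u = ∅ ∨
      ¬ ((∀ v ∈ kappa G B u, ua hG (.vb v B)) ∧ B = kappa G B u ∪ {u})) := by
  rw [ua]
  exact ⟨fun h => h.2, fun h => ⟨hp, h⟩⟩

theorem ua_vb {G : SimpleGraph V} (hG : IsConnectedBlockGraph G) (B : Finset V) (u : V) :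
    ua hG (.vb u B) ↔ ∃ B' ∈ beta G u B, ua hG (.bv B' u) := by
  rw [ua]
  simp only [exists_prop]

theorem cap_bv {G : SimpleGraph V} (hG : IsConnectedBlockGraph G) {B : Finset V} {u : V}
    (hp : Arc.bv B u ∈ arcs G) (C : Finset V) :
    cap hG (.bv B u) C = (∑ v ∈ kappa G B u, cap hG (.vb v B) (restrict G C (.vb v B))) +
      uaInt hG (.bv B u) - ((B ∩ interiorOf (.bv B u) C).card : ℤ) := by
  rw [cap, dif_pos hp,
    ← Finset.sum_coe_sort (kappa G B u) fun v => cap hG (.vb v B) (restrict G C (.vb v B))]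

open scoped Classical in
theorem cap_vb {G : SimpleGraph V} (hG : IsConnectedBlockGraph G) (B : Finset V) (u : V)
    (C : Finset V) :
    cap hG (.vb u B) C =
      if ∃ B' ∈ beta G u B,
          cap hG (.bv B' u) (restrict G C (.bv B' u)) = 0 ∧ ua hG (.bv B' u) then 0
      else (∑ B' ∈ beta G u B,
        (cap hG (.bv B' u) (restrict G C (.bv B' u)) - uaInt hG (.bv B' u))) +
          uaInt hG (.vb u B) := by
  rw [cap, ← Finset.sum_coe_sort (beta G u B) fun B' =>
    (cap hG (.bv B' u) (restrict G C (.bv B' u)) - uaInt hG (.bv B' u))]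
  simp only [Subtype.exists, exists_prop]

end TokenSliding

open TokenSliding

/-! Add to the capacity of `C[p]` the number of tokens of `C` in `G[p]` away from the base. In this
`weight` a token on a block `B` counts `+1` as a token and `-1` in the capacity, so the weight at
`(B, u)` is the sum of the weights at the `(v, B)` plus a constant (`weight_bv`). At `(u, B)` it is
also linear in the weights below, except when some block blocks `u`. The potential is the largest
weight over the reachable sets minus the fixed inner count of `C`, so the question is how maxima
over reachable sets pass through this recursion.

They do because one reachable set can maximise the weight at `p` and at every arc below `p`
simultaneously (`Optimal`). Three kinds of local moves, none of which lowers a weight at or below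
`p`, are constructed by induction on the block-tree. `CanClear` empties the neighbourhood of the
base inside `G[p]`, `CanPush` moves a token from the base into the interior, and `CanPull` moves an
inner token to the base, provided that the set is optimal, that some reachable set has fewer inner
tokens and that nothing outside is in the way. Slides that do not touch the interior can be copied
and slides within it ignored, so these moves let optimal sets follow every sequence of slides while
agreeing with it outside the interior (`Optimal.simulate`). Consequently optimal sets for parts with
disjoint interiors combine into one (`exists_optimal_family`), and following a sequence back to `C`
restores the original number of inner tokens, which is (iii).

The case distinction in (ii) comes from `Frozen`. A block is saturated if `ua` holds and no
reachable set gives it a weight above the inner count of `C`; for optimal sets this says that the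
potential is zero (`saturated_iff`). A token arriving at `u` leaves the interior of at most one
block, while the capacity of any other saturated block remains zero and forbids the arrival. With
two saturated blocks `u` is therefore never occupied, no inner count at `u` changes, and the
potential of `(u, B)` vanishes. Otherwise `linearWeight` bounds the weight at `(u, B)` and is
attained by a set that leaves `u` unblocked (`exists_optimal_unblocked`). Evaluating all potentials
at one optimal set gives (i) and (ii). -/

namespace TokenSliding

variable {V : Type*} [Fintype V] [DecidableEq V] {G : SimpleGraph V}

/-! ### The decomposition of a block graph along the block-tree -/

/-- The interior of `G[p]`: its vertices other than the base. -/
noncomputable def inner (G : SimpleGraph V) (p : Arc V) : Finset V :=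
  (verts G p).erase p.base

theorem mem_inner {p : Arc V} {x : V} : x ∈ inner G p ↔ x ≠ p.base ∧ x ∈ verts G p := by
  simp [inner]

theorem base_notMem_inner (p : Arc V) : p.base ∉ inner G p := by
  simp [inner]

theorem mem_verts_iff {p : Arc V} {x : V} : x ∈ verts G p ↔ x = p.base ∨ x ∈ inner G p := by
  rw [mem_inner]
  constructor
  · intro h
    by_cases hx : x = p.base <;> simp [hx, h]
  · rintro (rfl | h)
    · exact base_mem_verts G p
    · exact h.2

omit [Fintype V] [DecidableEq V] in
/-- An edge avoiding the base of `p` is not removed in `G[p]`. -/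
theorem notMem_cutEdges {p : Arc V} {x y : V} (hx : x ≠ p.base) (hy : y ≠ p.base) :
    s(x, y) ∉ cutEdges G p := by
  cases p <;>
  · rintro ⟨-, w, -, hw⟩
    rcases Sym2.eq_iff.1 hw with ⟨h, -⟩ | ⟨-, h⟩
    · exact hx h
    · exact hy h

/-- All removed edges are incident with the base, so the interior can be left only through the base.
-/
theorem mem_verts_of_mem_inner_adj {p : Arc V} {x y : V} (hx : x ∈ inner G p)
    (h : G.Adj x y) : y ∈ verts G p := by
  rw [mem_inner] at hx
  by_cases hy : y = p.base
  · exact hy ▸ base_mem_verts G p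
  · exact mem_verts_of_adj hx.2 h (notMem_cutEdges hx.1 hy)

theorem mem_inner_of_mem_inner_adj {p : Arc V} {x y : V} (hx : x ∈ inner G p)
    (h : G.Adj x y) (hy : y ≠ p.base) : y ∈ inner G p :=
  mem_inner.2 ⟨hy, mem_verts_of_mem_inner_adj hx h⟩

/-- Edges at the base `v` of `(v, B)` that leave `B` survive in `G[v, B]`. -/
theorem mem_inner_vb_of_adj {B : Finset V} {v y : V} (h : G.Adj v y) (hy : y ∉ B) :
    y ∈ inner G (.vb v B) := by
  refine mem_inner.2 ⟨h.ne', mem_verts_of_adj (base_mem_verts G (.vb v B)) h ?_⟩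
  rintro ⟨-, w, hw, he⟩
  rcases Sym2.eq_iff.1 he with ⟨-, h1⟩ | ⟨-, h1⟩
  · exact hy (h1 ▸ hw)
  · exact h.ne' h1

theorem mem_inner_bv_of_adj {B : Finset V} {u y : V} (h : G.Adj u y) (hy : y ∈ B) :
    y ∈ inner G (.bv B u) := by
  refine mem_inner.2 ⟨h.ne', mem_verts_of_adj (base_mem_verts G (.bv B u)) h ?_⟩
  rintro ⟨-, w, hw, he⟩
  rcases Sym2.eq_iff.1 he with ⟨-, h1⟩ | ⟨-, h1⟩
  · exact hw (h1 ▸ hy)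
  · exact h.ne' h1

omit [Fintype V] [DecidableEq V] in
theorem notMem_block_of_notMem_cutEdges {B : Finset V} {v x : V} (h : G.Adj v x)
    (hx : s(v, x) ∉ cutEdges G (.vb v B)) : x ∉ B :=
  fun hxB => hx ⟨h, x, hxB, rfl⟩

omit [Fintype V] in
theorem mem_block_of_notMem_cutEdges {B : Finset V} {u x : V} (h : G.Adj u x)
    (hx : s(u, x) ∉ cutEdges G (.bv B u)) : x ∈ B := by
  by_contra hxB
  exact hx ⟨h, x, hxB, rfl⟩

theorem mem_blocksAt {S B : Finset V} {u : V} : B ∈ blocksAt G S u ↔ IsBlock G S B ∧ u ∈ B := by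
  simp [blocksAt]

theorem mem_cutVertices {S : Finset V} {u : V} : u ∈ cutVertices G S ↔ IsCutVertex G S u := by
  simp [cutVertices]

theorem mem_arcs_vb {u : V} {B : Finset V} : Arc.vb u B ∈ arcs G ↔
    IsCutVertex G Finset.univ u ∧ IsBlock G Finset.univ B ∧ u ∈ B := by
  simp [arcs, Arc.base, Arc.block, mem_blocksAt, mem_cutVertices]

theorem mem_arcs_bv {u : V} {B : Finset V} : Arc.bv B u ∈ arcs G ↔
    IsCutVertex G Finset.univ u ∧ IsBlock G Finset.univ B ∧ u ∈ B := by
  simp [arcs, Arc.base, Arc.block, mem_blocksAt, mem_cutVertices]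

/-! ### Disjointness and nesting of the parts around a block -/

section Block

variable (hG : IsConnectedBlockGraph G) {B B' : Finset V} {u v : V}
  (hB : IsBlock G Finset.univ B)

include hG hB

theorem adj_of_mem_block (hu : u ∈ B) (hv : v ∈ B) (huv : u ≠ v) : G.Adj u v :=
  hG.isClique B hB hu hv huv

theorem notMem_inner_vb_of_mem_block (hv : v ∈ B) (hu : u ∈ B) : u ∉ inner G (.vb v B) := by
  intro h
  rw [mem_inner] at h
  exact not_mem_verts_of_mem_block hB (hG.isClique B hB) hu hv h.1 h.2

theorem block_sdiff_subset_inner_bv (hu : u ∈ B) : B.erase u ⊆ inner G (.bv B u) := by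
  intro y hy
  rw [Finset.mem_erase] at hy
  exact mem_inner_bv_of_adj (adj_of_mem_block hG hB hu hy.2 hy.1.symm) hy.2

/-- The complement of the interior of `G[u, B]` contains `u` and is closed under the edges of `G[B,
u]`: such an edge leads from `u` into `B`, and elsewhere the interior can be entered only from `u`.
-/
theorem disjoint_inner_vb_inner_bv (hu : u ∈ B) :
    Disjoint (inner G (.vb u B)) (inner G (.bv B u)) := by
  have key : verts G (.bv B u) ⊆ Finset.univ.filter fun x => x ∉ inner G (.vb u B) := by
    refine verts_subset (by simp [Arc.base, mem_inner]) ?_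
    intro x hx _ y hxy hc
    simp only [Finset.mem_filter, Finset.mem_univ, true_and] at hx ⊢
    intro hy
    by_cases hxu : x = u
    · subst hxu
      exact notMem_inner_vb_of_mem_block hG hB hu (mem_block_of_notMem_cutEdges hxy hc) hy
    · exact hx (mem_inner_of_mem_inner_adj hy hxy.symm hxu)
  rw [Finset.disjoint_left]
  intro x hx hx'
  have := key (mem_inner.1 hx').2
  simp at this
  exact this hx

theorem mem_block_of_mem_inner_bv_adj (hu : u ∈ B) {y : V} (hy : y ∈ inner G (.bv B u))
    (h : G.Adj u y) : y ∈ B := by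
  by_contra hyB
  exact Finset.disjoint_left.1 (disjoint_inner_vb_inner_bv hG hB hu)
    (mem_inner_vb_of_adj h hyB) hy

theorem verts_vb_disjoint (hu : u ∈ B) (hv : v ∈ B) (huv : u ≠ v) :
    Disjoint (verts G (.vb u B)) (verts G (.vb v B)) := by
  have hc := hG.isClique B hB
  have key : verts G (.vb u B) ⊆ Finset.univ.filter fun x => x ∉ verts G (.vb v B) := by
    refine verts_subset ?_ ?_
    · simpa [Arc.base] using not_mem_verts_of_mem_block hB hc hu hv huv
    intro x hx hxu y hxy hcut
    simp only [Finset.mem_filter, Finset.mem_univ, true_and] at hx ⊢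
    intro hy
    rcases mem_verts_iff.1 hy with h | h
    · simp only [Arc.base] at h
      subst h
      exact not_mem_verts_of_mem_block hB hc hv hu huv.symm (mem_verts_of_adj hxu hxy hcut)
    · exact hx (mem_verts_of_mem_inner_adj h hxy.symm)
  rw [Finset.disjoint_left]
  intro x hx hx'
  have := key hx
  simp at this
  exact this hx'

theorem verts_vb_subset_inner_bv (hu : u ∈ B) (hv : v ∈ B) (huv : v ≠ u) :
    verts G (.vb v B) ⊆ inner G (.bv B u) := by
  have hc := hG.isClique B hB
  have hnu := not_mem_verts_of_mem_block hB hc hu hv huv.symm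
  refine verts_subset ?_ ?_
  · exact block_sdiff_subset_inner_bv hG hB hu (Finset.mem_erase.2 ⟨huv, hv⟩)
  intro x hx hxv y hxy hcut
  refine mem_inner_of_mem_inner_adj hx hxy ?_
  rintro rfl
  exact hnu (mem_verts_of_adj hxv hxy hcut)

omit hG hB in
theorem exists_mem_verts_vb_of_mem_inner_bv {x : V} (hx : x ∈ inner G (.bv B u)) :
    ∃ v ∈ B, v ≠ u ∧ x ∈ verts G (.vb v B) := by
  have key : verts G (.bv B u) ⊆ Finset.univ.filter fun x => x = u ∨ ∃ v ∈ B, v ≠ u ∧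
      x ∈ verts G (.vb v B) := by
    refine verts_subset (by simp [Arc.base]) ?_
    intro x hx _ y hxy hcut
    simp only [Finset.mem_filter, Finset.mem_univ, true_and] at hx ⊢
    by_cases hyu : y = u
    · exact Or.inl hyu
    refine Or.inr ?_
    have hyB : y ∈ B → ∃ v ∈ B, v ≠ u ∧ y ∈ verts G (.vb v B) := fun hyB =>
      ⟨y, hyB, hyu, base_mem_verts G (.vb y B)⟩
    rcases hx with rfl | ⟨v, hv, hvu, hx⟩
    · exact hyB (mem_block_of_notMem_cutEdges hxy hcut)
    · by_cases hy : y ∈ B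
      · exact hyB hy
      refine ⟨v, hv, hvu, ?_⟩
      rcases mem_verts_iff.1 hx with rfl | hx
      · exact (mem_inner.1 (mem_inner_vb_of_adj hxy hy)).2
      · exact mem_verts_of_mem_inner_adj hx hxy
  have := key (mem_inner.1 hx).2
  simp only [Finset.mem_filter, Finset.mem_univ, true_and] at this
  exact this.resolve_left (mem_inner.1 hx).1

/-- Two blocks that share two vertices are equal. -/
theorem block_subset_of_two_mem (hB' : IsBlock G Finset.univ B') (huv : u ≠ v) (hu : u ∈ B)
    (hv : v ∈ B) (hu' : u ∈ B') (hv' : v ∈ B') : B' ⊆ B := by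
  intro z hz
  by_contra hzB
  have hzu : z ≠ u := by rintro rfl; exact hzB hu
  have hzv : z ≠ v := by rintro rfl; exact hzB hv
  refine notMem_inner_vb_of_mem_block hG hB hu hv ?_
  exact mem_inner_of_mem_inner_adj
    (mem_inner_vb_of_adj (adj_of_mem_block hG hB' hu' hz hzu.symm) hzB)
    (adj_of_mem_block hG hB' hz hv' hzv) huv.symm

theorem block_eq_of_two_mem (hB' : IsBlock G Finset.univ B') (huv : u ≠ v) (hu : u ∈ B)
    (hv : v ∈ B) (hu' : u ∈ B') (hv' : v ∈ B') : B = B' :=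
  (block_subset_of_two_mem hG hB' hB huv hu' hv' hu hv).antisymm
    (block_subset_of_two_mem hG hB hB' huv hu hv hu' hv')

theorem inner_bv_subset_inner_vb (hB' : IsBlock G Finset.univ B') (hu : u ∈ B) (hu' : u ∈ B')
    (hne : B' ≠ B) : inner G (.bv B' u) ⊆ inner G (.vb u B) := by
  suffices verts G (.bv B' u) ⊆ verts G (.vb u B) from Finset.erase_subset_erase _ this
  refine verts_subset (base_mem_verts G (.vb u B)) ?_
  intro x hx _ y hxy hcut
  rcases mem_verts_iff.1 hx with rfl | hx
  · refine (mem_inner.1 (mem_inner_vb_of_adj hxy ?_)).2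
    intro hyB
    exact hne (block_eq_of_two_mem hG hB hB' hxy.ne hu hyB hu'
      (mem_block_of_notMem_cutEdges hxy hcut)).symm
  · exact mem_verts_of_mem_inner_adj hx hxy

theorem disjoint_inner_bv (hB' : IsBlock G Finset.univ B') (hu : u ∈ B) (hu' : u ∈ B')
    (hne : B' ≠ B) : Disjoint (inner G (.bv B' u)) (inner G (.bv B u)) :=
  (disjoint_inner_vb_inner_bv hG hB hu).mono_left
    (inner_bv_subset_inner_vb hG hB hB' hu hu' hne)

end Block

/-! ### Blocks and cut-vertices of the parts -/

/-- Extending the pair to a maximal 2-connected set puts every edge in a block. -/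
theorem isTwoConnected_pair {x y : V} (h : G.Adj x y) : IsTwoConnected G {x, y} := by
  have hne := h.ne
  have hx : x ∈ ((({x, y} : Finset V)) : Set V) := by simp
  have hy : y ∈ ((({x, y} : Finset V)) : Set V) := by simp
  have hxy : (G.induce (({x, y} : Finset V) : Set V)).Reachable ⟨x, hx⟩ ⟨y, hy⟩ :=
    SimpleGraph.Adj.reachable (SimpleGraph.induce_adj.2 h)
  have hpre : (G.induce (({x, y} : Finset V) : Set V)).Preconnected := by
    rintro ⟨a, ha⟩ ⟨b, hb⟩
    have ha' : a = x ∨ a = y := by simpa using ha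
    have hb' : b = x ∨ b = y := by simpa using hb
    rcases ha' with rfl | rfl <;> rcases hb' with rfl | rfl
    · exact SimpleGraph.Reachable.refl _
    · exact hxy
    · exact hxy.symm
    · exact SimpleGraph.Reachable.refl _
  refine ⟨?_, fun v hv => ?_⟩
  · have : Nonempty ((({x, y} : Finset V)) : Set V) := ⟨⟨x, hx⟩⟩
    exact ⟨hpre⟩
  · refine not_isCutVertex_of_preconnected ?_ hv
    have hv' := hv.1
    rintro ⟨a, ha⟩ ⟨b, hb⟩
    have : a = b := by
      simp only [Finset.coe_erase, Set.mem_sdiff, Finset.mem_coe, Finset.mem_insert,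
        Finset.mem_singleton, Set.mem_singleton_iff] at ha hb hv'
      grind
    subst this
    exact SimpleGraph.Reachable.refl _

theorem exists_block_of_isTwoConnected {T : Finset V} (hT : IsTwoConnected G T) :
    ∃ B, T ⊆ B ∧ IsBlock G Finset.univ B := by
  obtain ⟨B, hTB, hB⟩ := (Set.toFinite {T : Finset V | T ⊆ Finset.univ ∧
    IsTwoConnected G T}).exists_le_maximal (a := T) ⟨Finset.subset_univ _, hT⟩
  exact ⟨B, hTB, hB⟩

/-- A vertex whose neighbours form part of a clique is not a cut-vertex. -/
theorem not_isCutVertex_of_forall_adj_mem {S B : Finset V} {v : V}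
    (hS : (G.induce (S : Set V)).Preconnected) (hB : G.IsClique (B : Set V))
    (h : ∀ y ∈ S, G.Adj v y → y ∈ B) : ¬ IsCutVertex G S v := by
  intro hv
  refine not_isCutVertex_of_preconnected ?_ hv
  rintro ⟨x, hx⟩ ⟨y, hy⟩
  set S' : Set V := ((S.erase v : Finset V) : Set V) with hS'
  have hx1 : x ≠ v ∧ x ∈ S := Finset.mem_erase.1 hx
  have hy1 : y ≠ v ∧ y ∈ S := Finset.mem_erase.1 hy
  -- Invariant along a walk from `x` in `G[S]`. When the walk stands on the deleted vertex `v`, what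
  -- is remembered is a vertex of the clique reached before; the clique edge from it to the next
  -- vertex bypasses `v`.
  let P : {z // z ∈ (S : Set V)} → Prop := fun z =>
    (∀ hz : (z : V) ∈ S', (G.induce S').Reachable ⟨x, hx⟩ ⟨z, hz⟩) ∧
    ((z : V) = v → ∃ b ∈ B, ∃ hb : b ∈ S', (G.induce S').Reachable ⟨x, hx⟩ ⟨b, hb⟩)
  have hr := hS ⟨x, hx1.2⟩ ⟨y, hy1.2⟩
  rw [SimpleGraph.reachable_iff_reflTransGen] at hr
  suffices ∀ z, Relation.ReflTransGen (G.induce (S : Set V)).Adj ⟨x, hx1.2⟩ z → P z from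
    (this _ hr).1 hy
  intro z hz
  induction hz with
  | refl => exact ⟨fun _ => SimpleGraph.Reachable.refl _, fun h => absurd h hx1.1⟩
  | @tail a b _ hab ih =>
    obtain ⟨a, ha⟩ := a
    obtain ⟨b, hb⟩ := b
    have hab : G.Adj a b := hab
    refine ⟨fun hb' => ?_, fun hbv => ?_⟩
    · by_cases hav : a = v
      · obtain ⟨c, hcB, hc, hr⟩ := ih.2 hav
        by_cases hcb : c = b
        · subst hcb
          exact hr
        · subst hav
          exact hr.trans (SimpleGraph.Adj.reachable
            (SimpleGraph.induce_adj.2 (hB hcB (h b hb hab) hcb)))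
      · have ha' : a ∈ S' := Finset.mem_coe.2 (Finset.mem_erase.2 ⟨hav, ha⟩)
        exact (ih.1 ha').trans (SimpleGraph.Adj.reachable (SimpleGraph.induce_adj.2 hab))
    · have hbv : b = v := hbv
      subst hbv
      have ha' : a ∈ S' := Finset.mem_coe.2 (Finset.mem_erase.2 ⟨hab.ne, ha⟩)
      exact ⟨a, h a ha hab.symm, ha', ih.1 ha'⟩

/-- A vertex that separates a set `T` from the other vertices is a cut-vertex. -/
theorem isCutVertex_of_closed {S T : Finset V} {v x y : V}
    (hS : (G.induce (S : Set V)).Preconnected) (hv : v ∈ S) (hx : x ∈ S) (hy : y ∈ S)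
    (hxv : x ≠ v) (hyv : y ≠ v) (hxT : x ∈ T) (hyT : y ∉ T)
    (h : ∀ a ∈ T, ∀ b, b ≠ v → G.Adj a b → b ∈ T) : IsCutVertex G S v := by
  refine ⟨hv, ?_⟩
  have h1 : Nat.card (G.induce (S : Set V)).ConnectedComponent ≤ 1 :=
    Finite.card_le_one_iff_subsingleton.2 hS.subsingleton_connectedComponent
  refine lt_of_le_of_lt h1 ?_
  rw [Finite.one_lt_card_iff_nontrivial]
  set S' : Set V := ((S.erase v : Finset V) : Set V) with hS'
  have hx' : x ∈ S' := Finset.mem_coe.2 (Finset.mem_erase.2 ⟨hxv, hx⟩)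
  have hy' : y ∈ S' := Finset.mem_coe.2 (Finset.mem_erase.2 ⟨hyv, hy⟩)
  refine ⟨(G.induce S').connectedComponentMk ⟨x, hx'⟩,
    (G.induce S').connectedComponentMk ⟨y, hy'⟩, fun he => hyT ?_⟩
  have hr := SimpleGraph.ConnectedComponent.exact he
  rw [SimpleGraph.reachable_iff_reflTransGen] at hr
  have : ∀ z : S', Relation.ReflTransGen (G.induce S').Adj ⟨x, hx'⟩ z → (z : V) ∈ T := by
    intro z hz
    induction hz with
    | refl => exact hxT
    | @tail a b _ hab ih => exact h _ ih _ (Finset.mem_erase.1 b.2).1 hab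
  exact this _ hr

theorem preconnected_induce_univ (hG : IsConnectedBlockGraph G) :
    (G.induce ((Finset.univ : Finset V) : Set V)).Preconnected := by
  rw [Finset.coe_univ]
  exact (SimpleGraph.induceUnivIso G).preconnected_iff.2 hG.connected.preconnected

theorem preconnected_induce_verts (p : Arc V) :
    (G.induce (verts G p : Set V)).Preconnected := by
  have key : ∀ x (hx : x ∈ (verts G p : Set V)),
      (G.induce (verts G p : Set V)).Reachable ⟨p.base, base_mem_verts G p⟩ ⟨x, hx⟩ := by
    classical
    let S' : Finset V := Finset.univ.filter fun x => ∃ hx : x ∈ (verts G p : Set V),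
      (G.induce (verts G p : Set V)).Reachable ⟨p.base, base_mem_verts G p⟩ ⟨x, hx⟩
    have hsub : verts G p ⊆ S' := by
      refine verts_subset ?_ ?_
      · simp only [S', Finset.mem_filter, Finset.mem_univ, true_and]
        exact ⟨base_mem_verts G p, SimpleGraph.Reachable.refl _⟩
      · intro x hx hxv y hxy hc
        simp only [S', Finset.mem_filter, Finset.mem_univ, true_and] at hx ⊢
        obtain ⟨hx', hr⟩ := hx
        exact ⟨mem_verts_of_adj hxv hxy hc,
          hr.trans (SimpleGraph.Adj.reachable (SimpleGraph.induce_adj.2 hxy))⟩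
    intro x hx
    have := hsub hx
    simp only [S', Finset.mem_filter, Finset.mem_univ, true_and] at this
    exact this.2
  rintro ⟨x, hx⟩ ⟨y, hy⟩
  exact (key x hx).symm.trans (key y hy)

/-! ### Cut-vertices of the parts, and the sets `κ` and `β` -/

section Block

variable (hG : IsConnectedBlockGraph G) {B B' : Finset V} {u v : V}

include hG

theorem inner_vb_nonempty_of_isCutVertex (hB : IsBlock G Finset.univ B) {S : Finset V}
    (hS : (G.induce (S : Set V)).Preconnected) (h : IsCutVertex G S v) :
    ∃ y ∈ inner G (.vb v B), G.Adj v y := by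
  by_contra! hne
  refine not_isCutVertex_of_forall_adj_mem hS (hG.isClique B hB) ?_ h
  intro y _ hy
  by_contra hyB
  exact hne y (mem_inner_vb_of_adj hy hyB) hy

theorem isCutVertex_of_inner_vb_nonempty (hB : IsBlock G Finset.univ B) {S : Finset V}
    (hS : (G.induce (S : Set V)).Preconnected) (hu : u ∈ B) (hv : v ∈ B) (huv : v ≠ u)
    (huS : u ∈ S) (hsub : verts G (.vb v B) ⊆ S) {y : V} (hy : y ∈ inner G (.vb v B)) :
    IsCutVertex G S v :=
  isCutVertex_of_closed (T := inner G (.vb v B)) hS (hsub (base_mem_verts G (.vb v B)))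
    (hsub (mem_inner.1 hy).2) huS (mem_inner.1 hy).1 huv.symm hy
    (notMem_inner_vb_of_mem_block hG hB hv hu)
    fun _ ha _ hb hab => mem_inner_of_mem_inner_adj ha hab hb

/-- Replaces the counting of components by a condition on parts. If `v` had no neighbour outside the
clique `B` it would not be a cut-vertex; conversely, `v` separates the interior of `G[v, B]` from
`u`. -/
theorem mem_kappa (hp : Arc.bv B u ∈ arcs G) :
    v ∈ kappa G B u ↔ v ∈ B ∧ v ≠ u ∧ (inner G (.vb v B)).Nonempty := by
  obtain ⟨-, hB, hu⟩ := mem_arcs_bv.1 hp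
  rw [kappa, Finset.mem_inter, mem_cutVertices]
  constructor
  · rintro ⟨hv, hcut⟩
    refine ⟨hv, ?_, ?_⟩
    · rintro rfl
      exact not_isCutVertex_base (hG.isClique B hB) hu hcut
    · obtain ⟨y, hy, -⟩ :=
        inner_vb_nonempty_of_isCutVertex hG hB (preconnected_induce_verts _) hcut
      exact ⟨y, hy⟩
  · rintro ⟨hv, hvu, y, hy⟩
    exact ⟨hv, isCutVertex_of_inner_vb_nonempty hG hB (preconnected_induce_verts _) hu hv hvu
      (base_mem_verts G (.bv B u))
      ((verts_vb_subset_inner_bv hG hB hu hv hvu).trans (Finset.erase_subset _ _)) hy⟩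

theorem vb_mem_arcs_of_mem_kappa (hp : Arc.bv B u ∈ arcs G) (hv : v ∈ kappa G B u) :
    Arc.vb v B ∈ arcs G := by
  obtain ⟨-, hB, hu⟩ := mem_arcs_bv.1 hp
  obtain ⟨hvB, hvu, y, hy⟩ := (mem_kappa hG hp).1 hv
  exact mem_arcs_vb.2 ⟨isCutVertex_of_inner_vb_nonempty hG hB (preconnected_induce_univ hG) hu
    hvB hvu (Finset.mem_univ _) (Finset.subset_univ _) hy, hB, hvB⟩

theorem mem_beta (hp : Arc.vb u B ∈ arcs G) :
    B' ∈ beta G u B ↔ B' ∈ blocksAt G Finset.univ u ∧ B' ≠ B := by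
  obtain ⟨hcut, hB, hu⟩ := mem_arcs_vb.1 hp
  have hsub : ∀ B', IsBlock G Finset.univ B' → u ∈ B' → B' ≠ B → B' ⊆ verts G (.vb u B) := by
    intro B' hB' hu' hne y hy
    by_cases hyu : y = u
    · exact hyu ▸ base_mem_verts G (.vb u B)
    · exact (mem_inner.1 (inner_bv_subset_inner_vb hG hB hB' hu hu' hne
        (block_sdiff_subset_inner_bv hG hB' hu' (Finset.mem_erase.2 ⟨hyu, hy⟩)))).2
  rw [beta, mem_blocksAt, mem_blocksAt]
  constructor
  · rintro ⟨hB', hu'⟩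
    obtain ⟨B'', hle, hB''⟩ := exists_block_of_isTwoConnected hB'.prop.2
    -- If the block of `G[u, B]` extended to `B` itself, it would lie in `{u}`, since `G[u, B]`
    -- meets `B` only in `u`. An edge from `u` to a vertex outside `B` would then contradict its
    -- maximality.
    by_cases hne : B'' = B
    · subst hne
      exfalso
      obtain ⟨y, hy, huy⟩ :=
        inner_vb_nonempty_of_isCutVertex hG hB (preconnected_induce_univ hG) hcut
      have hB1 : B' ⊆ {u, y} := by
        intro x hx
        by_contra hxu
        refine notMem_inner_vb_of_mem_block hG hB hu (hle hx) (mem_inner.2 ⟨?_, hB'.prop.1 hx⟩)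
        rintro rfl
        simp at hxu
      have h2 : ({u, y} : Finset V) ⊆ verts G (.vb u B'') := by
        intro x hx
        rcases Finset.mem_insert.1 hx with rfl | hx
        · exact base_mem_verts G (.vb x B'')
        · rw [Finset.mem_singleton.1 hx]
          exact (mem_inner.1 hy).2
      have := hB'.2 ⟨h2, isTwoConnected_pair huy⟩ hB1 (by simp : y ∈ ({u, y} : Finset V))
      exact notMem_inner_vb_of_mem_block hG hB hu (hle this) hy
    · have h1 := hsub B'' hB'' (hle hu') hne
      have h2 : B'' ⊆ B' := hB'.2 ⟨h1, hB''.prop.2⟩ hle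
      have : B' = B'' := hle.antisymm h2
      subst this
      exact ⟨⟨hB'', hu'⟩, hne⟩
  · rintro ⟨⟨hB', hu'⟩, hne⟩
    exact ⟨⟨⟨hsub B' hB' hu' hne, hB'.prop.2⟩, fun T hT hle =>
      hB'.2 ⟨Finset.subset_univ _, hT.2⟩ hle⟩, hu'⟩

theorem bv_mem_arcs_of_mem_beta (hp : Arc.vb u B ∈ arcs G) (h : B' ∈ beta G u B) :
    Arc.bv B' u ∈ arcs G := by
  obtain ⟨h1, -⟩ := (mem_beta hG hp).1 h
  rw [mem_blocksAt] at h1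
  exact mem_arcs_bv.2 ⟨(mem_arcs_vb.1 hp).1, h1⟩

omit hG in
theorem exists_block_of_adj {x y : V} (h : G.Adj x y) :
    ∃ B, IsBlock G Finset.univ B ∧ x ∈ B ∧ y ∈ B := by
  obtain ⟨B, hle, hB⟩ := exists_block_of_isTwoConnected (isTwoConnected_pair h)
  exact ⟨B, hB, hle (by simp), hle (by simp)⟩

/-- The interior of `G[u, B]` is the union of the interiors of the `G[B', u]`. -/
theorem exists_mem_inner_bv_of_mem_inner_vb {x : V} (hp : Arc.vb u B ∈ arcs G)
    (hx : x ∈ inner G (.vb u B)) : ∃ B' ∈ beta G u B, x ∈ inner G (.bv B' u) := by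
  have key : verts G (.vb u B) ⊆ Finset.univ.filter fun x => x = u ∨
      ∃ B' ∈ beta G u B, x ∈ inner G (.bv B' u) := by
    refine verts_subset (by simp [Arc.base]) ?_
    intro x hx _ y hxy hcut
    simp only [Finset.mem_filter, Finset.mem_univ, true_and] at hx ⊢
    by_cases hyu : y = u
    · exact Or.inl hyu
    refine Or.inr ?_
    rcases hx with rfl | ⟨B', hB', hx⟩
    · have hyB := notMem_block_of_notMem_cutEdges hxy hcut
      obtain ⟨B', hB', hx', hy'⟩ := exists_block_of_adj hxy
      refine ⟨B', (mem_beta hG hp).2 ⟨mem_blocksAt.2 ⟨hB', hx'⟩, ?_⟩, mem_inner_bv_of_adj hxy hy'⟩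
      rintro rfl
      exact hyB hy'
    · exact ⟨B', hB', mem_inner_of_mem_inner_adj hx hxy hyu⟩
  have := key (mem_inner.1 hx).2
  simp only [Finset.mem_filter, Finset.mem_univ, true_and] at this
  exact this.resolve_left (mem_inner.1 hx).1

end Block

/-! ### Capacity and weight -/

theorem arc_induction (hG : IsConnectedBlockGraph G) {P : Arc V → Prop}
    (hbv : ∀ B u, Arc.bv B u ∈ arcs G → (∀ v ∈ kappa G B u, P (.vb v B)) → P (.bv B u))
    (hvb : ∀ u B, Arc.vb u B ∈ arcs G → (∀ B' ∈ beta G u B, P (.bv B' u)) → P (.vb u B)) :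
    ∀ p ∈ arcs G, P p := by
  intro p
  induction hn : size G p using Nat.strong_induction_on generalizing p with
  | _ n ih =>
    intro hp
    subst hn
    cases p with
    | bv B u =>
      exact hbv B u hp fun v hv =>
        ih _ (size_lt_of_mem_kappa hG hp hv) _ rfl (vb_mem_arcs_of_mem_kappa hG hp hv)
    | vb u B =>
      exact hvb u B hp fun B' hB' =>
        ih _ (size_lt_of_mem_beta hB') _ rfl (bv_mem_arcs_of_mem_beta hG hp hB')

theorem uaInt_nonneg (hG : IsConnectedBlockGraph G) (p : Arc V) : 0 ≤ uaInt hG p := by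
  unfold uaInt; split_ifs <;> simp

theorem uaInt_le_one (hG : IsConnectedBlockGraph G) (p : Arc V) : uaInt hG p ≤ 1 := by
  unfold uaInt; split_ifs <;> simp

theorem uaInt_of_ua {hG : IsConnectedBlockGraph G} {p : Arc V} (h : ua hG p) :
    uaInt hG p = 1 := by
  simp [uaInt, h]

theorem uaInt_of_not_ua {hG : IsConnectedBlockGraph G} {p : Arc V} (h : ¬ ua hG p) :
    uaInt hG p = 0 := by
  simp [uaInt, h]

/-- The number of tokens of `C` in the interior of `G[p]`. -/
noncomputable def innerCount (G : SimpleGraph V) (p : Arc V) (C : Finset V) : ℤ :=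
  ((inner G p ∩ C).card : ℤ)

/-- The capacity of `C[p]`. -/
noncomputable def capAt (hG : IsConnectedBlockGraph G) (p : Arc V) (C : Finset V) : ℤ :=
  cap hG p (restrict G C p)

/-- The number of tokens in the interior of `G[p]` plus the capacity. -/
noncomputable def weight (hG : IsConnectedBlockGraph G) (p : Arc V) (C : Finset V) : ℤ :=
  capAt hG p C + innerCount G p C

theorem interiorOf_restrict (p : Arc V) (C : Finset V) :
    interiorOf p (restrict G C p) = inner G p ∩ C := by
  rw [interiorOf, restrict, inner, Finset.erase_inter]

theorem restrict_restrict {p q : Arc V} (h : verts G q ⊆ verts G p) (C : Finset V) :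
    restrict G (restrict G C p) q = restrict G C q := by
  ext x
  simp only [restrict, Finset.mem_inter]
  exact ⟨fun hx => ⟨hx.1, hx.2.2⟩, fun hx => ⟨hx.1, h hx.1, hx.2⟩⟩

theorem innerCount_congr {p : Arc V} {C D : Finset V}
    (h : ∀ x ∈ inner G p, x ∈ C ↔ x ∈ D) : innerCount G p C = innerCount G p D := by
  rw [innerCount, innerCount]
  congr 2
  ext x
  simp only [Finset.mem_inter]
  exact and_congr_right (h x)

/-! ### Recursive equations and bounds for capacities and weights -/

section Recursion

variable (hG : IsConnectedBlockGraph G) {B : Finset V} {u v : V}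

include hG

theorem verts_vb_subset_of_mem_kappa (hp : Arc.bv B u ∈ arcs G) (hv : v ∈ kappa G B u) :
    verts G (.vb v B) ⊆ inner G (.bv B u) := by
  obtain ⟨-, hB, hu⟩ := mem_arcs_bv.1 hp
  obtain ⟨hvB, hvu, -⟩ := (mem_kappa hG hp).1 hv
  exact verts_vb_subset_inner_bv hG hB hu hvB hvu

theorem inner_vb_subset_of_mem_kappa (hp : Arc.bv B u ∈ arcs G) (hv : v ∈ kappa G B u) :
    inner G (.vb v B) ⊆ inner G (.bv B u) :=
  (Finset.erase_subset _ _).trans (verts_vb_subset_of_mem_kappa hG hp hv)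

theorem inner_bv_subset_of_mem_beta {B' : Finset V} (hp : Arc.vb u B ∈ arcs G)
    (h : B' ∈ beta G u B) : inner G (.bv B' u) ⊆ inner G (.vb u B) := by
  obtain ⟨-, hB, hu⟩ := mem_arcs_vb.1 hp
  obtain ⟨h1, hne⟩ := (mem_beta hG hp).1 h
  obtain ⟨hB', hu'⟩ := mem_blocksAt.1 h1
  exact inner_bv_subset_inner_vb hG hB hB' hu hu' hne

theorem capAt_bv (hp : Arc.bv B u ∈ arcs G) (C : Finset V) :
    capAt hG (.bv B u) C = (∑ v ∈ kappa G B u, capAt hG (.vb v B) C) + uaInt hG (.bv B u) -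
      ((B.erase u ∩ C).card : ℤ) := by
  obtain ⟨-, hB, hu⟩ := mem_arcs_bv.1 hp
  rw [capAt, cap_bv hG hp]
  congr 1
  · congr 1
    refine Finset.sum_congr rfl fun v hv => ?_
    rw [capAt, restrict_restrict]
    exact (verts_vb_subset_of_mem_kappa hG hp hv).trans (Finset.erase_subset _ _)
  · rw [interiorOf_restrict, ← Finset.inter_assoc]
    congr 3
    ext x
    simp only [Finset.mem_inter, Finset.mem_erase]
    constructor
    · rintro ⟨hx, hx'⟩
      exact ⟨(mem_inner.1 hx').1, hx⟩
    · rintro ⟨hxu, hx⟩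
      exact ⟨hx, block_sdiff_subset_inner_bv hG hB hu (Finset.mem_erase.2 ⟨hxu, hx⟩)⟩

theorem restrict_bv_of_mem_beta {B' : Finset V} (hp : Arc.vb u B ∈ arcs G)
    (h : B' ∈ beta G u B) (C : Finset V) :
    restrict G (restrict G C (.vb u B)) (.bv B' u) = restrict G C (.bv B' u) := by
  refine restrict_restrict (fun x hx => ?_) C
  rcases mem_verts_iff.1 hx with h0 | hx
  · rw [h0]
    exact base_mem_verts G (.vb u B)
  · exact (mem_inner.1 (inner_bv_subset_of_mem_beta hG hp h hx)).2

open scoped Classical in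
theorem capAt_vb (hp : Arc.vb u B ∈ arcs G) (C : Finset V) :
    capAt hG (.vb u B) C =
      if ∃ B' ∈ beta G u B, capAt hG (.bv B' u) C = 0 ∧ ua hG (.bv B' u) then 0
      else (∑ B' ∈ beta G u B, (capAt hG (.bv B' u) C - uaInt hG (.bv B' u))) +
        uaInt hG (.vb u B) := by
  rw [capAt, cap_vb hG]
  have h : ∀ B' ∈ beta G u B, cap hG (.bv B' u) (restrict G (restrict G C (.vb u B)) (.bv B' u)) =
      capAt hG (.bv B' u) C := fun B' hB' => by
    rw [restrict_bv_of_mem_beta hG hp hB', capAt]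
  have h1 : (∃ B' ∈ beta G u B,
      cap hG (.bv B' u) (restrict G (restrict G C (.vb u B)) (.bv B' u)) = 0 ∧ ua hG (.bv B' u)) ↔
      ∃ B' ∈ beta G u B, capAt hG (.bv B' u) C = 0 ∧ ua hG (.bv B' u) := by
    refine exists_congr fun B' => and_congr_right fun hB' => ?_
    rw [h B' hB']
  simp only [h1]
  split_ifs
  · rfl
  · congr 1
    exact Finset.sum_congr rfl fun B' hB' => by rw [h B' hB']

theorem disjoint_inner_vb_of_ne (hp : Arc.bv B u ∈ arcs G) {v w : V} (hv : v ∈ B) (hw : w ∈ B)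
    (hvw : v ≠ w) : Disjoint (inner G (.vb v B)) (inner G (.vb w B)) :=
  (verts_vb_disjoint hG (mem_arcs_bv.1 hp).2.1 hv hw hvw).mono (Finset.erase_subset _ _)
    (Finset.erase_subset _ _)

theorem mem_inner_bv_iff (hp : Arc.bv B u ∈ arcs G) {x : V} :
    x ∈ inner G (.bv B u) ↔ x ∈ B.erase u ∨ ∃ v ∈ kappa G B u, x ∈ inner G (.vb v B) := by
  obtain ⟨-, hB, hu⟩ := mem_arcs_bv.1 hp
  constructor
  · intro hx
    obtain ⟨v, hv, hvu, hxv⟩ := exists_mem_verts_vb_of_mem_inner_bv hx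
    rcases mem_verts_iff.1 hxv with rfl | hxv
    · exact Or.inl (Finset.mem_erase.2 ⟨hvu, hv⟩)
    · exact Or.inr ⟨v, (mem_kappa hG hp).2 ⟨hv, hvu, x, hxv⟩, hxv⟩
  · rintro (hx | ⟨v, hv, hx⟩)
    · exact block_sdiff_subset_inner_bv hG hB hu hx
    · exact inner_vb_subset_of_mem_kappa hG hp hv hx

theorem innerCount_bv (hp : Arc.bv B u ∈ arcs G) (C : Finset V) :
    innerCount G (.bv B u) C = ((B.erase u ∩ C).card : ℤ) +
      ∑ v ∈ kappa G B u, innerCount G (.vb v B) C := by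
  obtain ⟨-, hB, hu⟩ := mem_arcs_bv.1 hp
  have h : inner G (.bv B u) ∩ C =
      (B.erase u ∩ C) ∪ (kappa G B u).biUnion fun v => inner G (.vb v B) ∩ C := by
    ext x
    simp only [Finset.mem_inter, mem_inner_bv_iff hG hp, Finset.mem_union, Finset.mem_biUnion]
    constructor
    · rintro ⟨h | ⟨v, hv, h⟩, hx⟩
      · exact Or.inl ⟨h, hx⟩
      · exact Or.inr ⟨v, hv, h, hx⟩
    · rintro (⟨h, hx⟩ | ⟨v, hv, h, hx⟩)
      · exact ⟨Or.inl h, hx⟩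
      · exact ⟨Or.inr ⟨v, hv, h⟩, hx⟩
  rw [innerCount, h, Finset.card_union_of_disjoint, Finset.card_biUnion]
  · push_cast
    rfl
  · intro v hv w hw hvw
    exact (disjoint_inner_vb_of_ne hG hp ((mem_kappa hG hp).1 hv).1
      ((mem_kappa hG hp).1 hw).1 hvw).mono Finset.inter_subset_left Finset.inter_subset_left
  · rw [Finset.disjoint_left]
    intro x hx hx'
    simp only [Finset.mem_inter, Finset.mem_biUnion, Finset.mem_erase] at hx hx'
    obtain ⟨v, hv, h, -⟩ := hx'
    exact notMem_inner_vb_of_mem_block hG hB ((mem_kappa hG hp).1 hv).1 hx.1.2 h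

theorem disjoint_inner_bv_of_ne {B₁ B₂ : Finset V} (h₁ : B₁ ∈ blocksAt G Finset.univ u)
    (h₂ : B₂ ∈ blocksAt G Finset.univ u) (hne : B₁ ≠ B₂) :
    Disjoint (inner G (.bv B₁ u)) (inner G (.bv B₂ u)) := by
  rw [mem_blocksAt] at h₁ h₂
  exact disjoint_inner_bv hG h₂.1 h₁.1 h₂.2 h₁.2 hne

theorem innerCount_vb (hp : Arc.vb u B ∈ arcs G) (C : Finset V) :
    innerCount G (.vb u B) C = ∑ B' ∈ beta G u B, innerCount G (.bv B' u) C := by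
  have h : inner G (.vb u B) ∩ C = (beta G u B).biUnion fun B' => inner G (.bv B' u) ∩ C := by
    ext x
    simp only [Finset.mem_inter, Finset.mem_biUnion]
    constructor
    · rintro ⟨h, hx⟩
      obtain ⟨B', hB', h'⟩ := exists_mem_inner_bv_of_mem_inner_vb hG hp h
      exact ⟨B', hB', h', hx⟩
    · rintro ⟨B', hB', h', hx⟩
      exact ⟨inner_bv_subset_of_mem_beta hG hp hB' h', hx⟩
  rw [innerCount, h, Finset.card_biUnion]
  · push_cast
    rfl
  · intro B₁ h₁ B₂ h₂ hne
    exact (disjoint_inner_bv_of_ne hG ((mem_beta hG hp).1 h₁).1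
      ((mem_beta hG hp).1 h₂).1 hne).mono Finset.inter_subset_left Finset.inter_subset_left

/-- The tokens on `B` other than `u` cancel: they are subtracted in the capacity and added in the
inner count. -/
theorem weight_bv (hp : Arc.bv B u ∈ arcs G) (C : Finset V) :
    weight hG (.bv B u) C = (∑ v ∈ kappa G B u, weight hG (.vb v B) C) +
      uaInt hG (.bv B u) := by
  simp only [weight, capAt_bv hG hp, innerCount_bv hG hp, Finset.sum_add_distrib]
  ring

/-- Capacities ignore the base: the block term counts only interior tokens, and everything else is
inherited from smaller interiors. Slides outside an interior therefore change nothing there. -/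
theorem capAt_congr {p : Arc V} (hp : p ∈ arcs G) : ∀ {C D : Finset V},
    (∀ x ∈ inner G p, x ∈ C ↔ x ∈ D) → capAt hG p C = capAt hG p D := by
  refine arc_induction hG (P := fun p => ∀ {C D : Finset V},
    (∀ x ∈ inner G p, x ∈ C ↔ x ∈ D) → capAt hG p C = capAt hG p D) ?_ ?_ p hp
  · intro B u hp ih C D h
    obtain ⟨-, hB, hu⟩ := mem_arcs_bv.1 hp
    rw [capAt_bv hG hp, capAt_bv hG hp]
    congr 1
    · congr 1
      exact Finset.sum_congr rfl fun v hv =>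
        ih v hv fun x hx => h x (inner_vb_subset_of_mem_kappa hG hp hv hx)
    · congr 2
      ext x
      simp only [Finset.mem_inter]
      exact and_congr_right fun hx => h x (block_sdiff_subset_inner_bv hG hB hu hx)
  · intro u B hp ih C D h
    have h' : ∀ B' ∈ beta G u B, capAt hG (.bv B' u) C = capAt hG (.bv B' u) D :=
      fun B' hB' => ih B' hB' fun x hx => h x (inner_bv_subset_of_mem_beta hG hp hB' hx)
    rw [capAt_vb hG hp, capAt_vb hG hp]
    have h1 : (∃ B' ∈ beta G u B, capAt hG (.bv B' u) C = 0 ∧ ua hG (.bv B' u)) ↔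
        ∃ B' ∈ beta G u B, capAt hG (.bv B' u) D = 0 ∧ ua hG (.bv B' u) :=
      exists_congr fun B' => and_congr_right fun hB' => by rw [h' B' hB']
    by_cases hb : ∃ B' ∈ beta G u B, capAt hG (.bv B' u) D = 0 ∧ ua hG (.bv B' u)
    · rw [if_pos (h1.2 hb), if_pos hb]
    · rw [if_neg (mt h1.1 hb), if_neg hb]
      congr 1
      exact Finset.sum_congr rfl fun B' hB' => by rw [h' B' hB']

theorem weight_congr {p : Arc V} (hp : p ∈ arcs G) {C D : Finset V}
    (h : ∀ x ∈ inner G p, x ∈ C ↔ x ∈ D) : weight hG p C = weight hG p D := by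
  rw [weight, weight, capAt_congr hG hp h, innerCount_congr h]

/-- The linear expression that the weight at `(u, B)` equals when no block blocks `u`. -/
noncomputable def linearWeight (u : V) (B C : Finset V) : ℤ :=
  (∑ B' ∈ beta G u B, (weight hG (.bv B' u) C - uaInt hG (.bv B' u))) + uaInt hG (.vb u B)

theorem capAt_vb_of_blocked (hp : Arc.vb u B ∈ arcs G) {C : Finset V}
    {B' : Finset V} (hB' : B' ∈ beta G u B) (h0 : capAt hG (.bv B' u) C = 0)
    (hua : ua hG (.bv B' u)) : capAt hG (.vb u B) C = 0 := by
  rw [capAt_vb hG hp, if_pos ⟨B', hB', h0, hua⟩]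

/-- For independent sets the hypothesis is the negation of blocking, by `capAt_nonneg`. In this form
it follows from an occupied base and is inherited when capacities grow. -/
theorem capAt_vb_of_unblocked (hp : Arc.vb u B ∈ arcs G) {C : Finset V}
    (h : ∀ B' ∈ beta G u B, uaInt hG (.bv B' u) ≤ capAt hG (.bv B' u) C) :
    capAt hG (.vb u B) C = (∑ B' ∈ beta G u B,
      (capAt hG (.bv B' u) C - uaInt hG (.bv B' u))) + uaInt hG (.vb u B) := by
  rw [capAt_vb hG hp, if_neg]
  rintro ⟨B', hB', h0, hua⟩
  have := h B' hB'
  rw [h0, uaInt_of_ua hua] at this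
  omega

theorem weight_vb_of_unblocked (hp : Arc.vb u B ∈ arcs G) {C : Finset V}
    (h : ∀ B' ∈ beta G u B, uaInt hG (.bv B' u) ≤ capAt hG (.bv B' u) C) :
    weight hG (.vb u B) C = linearWeight hG u B C := by
  rw [weight, capAt_vb_of_unblocked hG hp h, innerCount_vb hG hp, linearWeight]
  simp only [weight, Finset.sum_sub_distrib, Finset.sum_add_distrib]
  ring

theorem uaInt_vb_of_mem_beta {B' : Finset V} (hB' : B' ∈ beta G u B)
    (hua : ua hG (.bv B' u)) : uaInt hG (.vb u B) = 1 :=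
  uaInt_of_ua ((ua_vb hG B u).2 ⟨B', hB', hua⟩)

/-- Capacities are non-negative, and leave room for the base of `p` to be occupied if it is. -/
theorem capAt_nonneg_aux {C : Finset V} (hC : G.IsIndepSet (C : Set V)) : ∀ p ∈ arcs G,
    0 ≤ capAt hG p C ∧ (p.base ∈ C → uaInt hG p ≤ capAt hG p C) := by
  refine arc_induction hG ?_ ?_
  · intro B u hp ih
    obtain ⟨-, hB, hu⟩ := mem_arcs_bv.1 hp
    have hsum : 0 ≤ ∑ v ∈ kappa G B u, capAt hG (.vb v B) C :=
      Finset.sum_nonneg fun v hv => (ih v hv).1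
    have hua := uaInt_nonneg hG (.bv B u)
    rw [capAt_bv hG hp]
    rcases Finset.eq_empty_or_nonempty (B.erase u ∩ C) with h0 | ⟨w, hw⟩
    · rw [h0]
      simp only [Finset.card_empty, Nat.cast_zero, sub_zero]
      exact ⟨by omega, fun _ => by omega⟩
    · simp only [Finset.mem_inter, Finset.mem_erase] at hw
      obtain ⟨⟨hwu, hwB⟩, hwC⟩ := hw
      have hone : (B.erase u ∩ C).card ≤ 1 := by
        rw [Finset.card_le_one]
        intro a ha b hb
        simp only [Finset.mem_inter, Finset.mem_erase] at ha hb
        by_contra hab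
        exact hC ha.2 hb.2 hab (adj_of_mem_block hG hB ha.1.2 hb.1.2 hab)
      have hone' : ((B.erase u ∩ C).card : ℤ) ≤ 1 := by exact_mod_cast hone
      refine ⟨?_, fun huC => absurd (adj_of_mem_block hG hB hwB hu hwu) (hC hwC huC hwu)⟩
      by_cases hu' : ua hG (.bv B u)
      · rw [uaInt_of_ua hu']
        omega
      · rw [uaInt_of_not_ua hu']
        rw [ua_bv hG hp, not_or, not_not] at hu'
        -- Since `ua` fails here, `w` lies in `κ` and `ua` holds at `(w, B)`. The token on `w` then
        -- forces capacity at least one there, which pays for its own cost.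
        obtain ⟨-, hall, heq⟩ := hu'
        have hwκ : w ∈ kappa G B u := by
          rw [heq] at hwB
          simpa [hwu] using hwB
        have h1 := (ih w hwκ).2 hwC
        rw [uaInt_of_ua (hall w hwκ)] at h1
        have := Finset.single_le_sum (fun v hv => (ih v hv).1) hwκ
        omega
  · intro u B hp ih
    have hua := uaInt_nonneg hG (.vb u B)
    have key : (∀ B' ∈ beta G u B, uaInt hG (.bv B' u) ≤ capAt hG (.bv B' u) C) →
        uaInt hG (.vb u B) ≤ capAt hG (.vb u B) C := by
      intro h
      rw [capAt_vb_of_unblocked hG hp h]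
      have : 0 ≤ ∑ B' ∈ beta G u B, (capAt hG (.bv B' u) C - uaInt hG (.bv B' u)) :=
        Finset.sum_nonneg fun B' hB' => by linarith [h B' hB']
      omega
    refine ⟨?_, fun huC => key fun B' hB' => (ih B' hB').2 huC⟩
    by_cases h : ∃ B' ∈ beta G u B, capAt hG (.bv B' u) C = 0 ∧ ua hG (.bv B' u)
    · obtain ⟨B', hB', h0, h1⟩ := h
      exact (capAt_vb_of_blocked hG hp hB' h0 h1).ge
    · refine hua.trans (key fun B' hB' => ?_)
      push Not at h
      by_cases h1 : ua hG (.bv B' u)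
      · rw [uaInt_of_ua h1]
        have h2 : capAt hG (.bv B' u) C ≠ 0 := fun h2 => h B' hB' h2 h1
        have := (ih B' hB').1
        omega
      · rw [uaInt_of_not_ua h1]
        exact (ih B' hB').1

theorem capAt_nonneg {C : Finset V} (hC : G.IsIndepSet (C : Set V)) {p : Arc V}
    (hp : p ∈ arcs G) : 0 ≤ capAt hG p C :=
  (capAt_nonneg_aux hG hC p hp).1

theorem uaInt_le_capAt {C : Finset V} (hC : G.IsIndepSet (C : Set V)) {p : Arc V}
    (hp : p ∈ arcs G) (h : p.base ∈ C) : uaInt hG p ≤ capAt hG p C :=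
  (capAt_nonneg_aux hG hC p hp).2 h

theorem uaInt_le_capAt_of_not_blocked {C : Finset V} (hC : G.IsIndepSet (C : Set V)) {p : Arc V}
    (hp : p ∈ arcs G) (h : ¬ (capAt hG p C = 0 ∧ ua hG p)) : uaInt hG p ≤ capAt hG p C := by
  have := capAt_nonneg hG hC hp
  by_cases h1 : ua hG p
  · have h2 : capAt hG p C ≠ 0 := fun h2 => h ⟨h2, h1⟩
    rw [uaInt_of_ua h1]
    omega
  · rwa [uaInt_of_not_ua h1]

/-- A blocking block contains a token. -/
theorem exists_mem_block_of_blocked {C : Finset V} (hC : G.IsIndepSet (C : Set V))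
    (hp : Arc.bv B u ∈ arcs G) (h0 : capAt hG (.bv B u) C = 0) (hua : ua hG (.bv B u)) :
    ∃ w ∈ B.erase u, w ∈ C := by
  by_contra! hne
  have h1 : B.erase u ∩ C = ∅ := by
    ext x
    simp only [Finset.mem_inter, Finset.notMem_empty, iff_false, not_and]
    exact hne x
  rw [capAt_bv hG hp, h1, uaInt_of_ua hua] at h0
  have : 0 ≤ ∑ v ∈ kappa G B u, capAt hG (.vb v B) C :=
    Finset.sum_nonneg fun v hv => capAt_nonneg hG hC (vb_mem_arcs_of_mem_kappa hG hp hv)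
  simp at h0
  omega

end Recursion

/-! ### Token slides -/

/-- `D` is obtained from `C` by a sequence of token slides. -/
abbrev Reach (G : SimpleGraph V) (C D : Finset V) : Prop :=
  Relation.ReflTransGen (Step G) C D

/-- The set `D` after the token on `a` has moved to `b`. -/
def slide (D : Finset V) (a b : V) : Finset V :=
  insert b (D.erase a)

section Slide

omit [Fintype V]

theorem mem_slide {D : Finset V} {a b x : V} : x ∈ slide D a b ↔ x = b ∨ (x ≠ a ∧ x ∈ D) := by
  simp [slide]

theorem mem_slide_of_ne {D : Finset V} {a b x : V} (ha : x ≠ a) (hb : x ≠ b) :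
    x ∈ slide D a b ↔ x ∈ D := by
  simp [mem_slide, ha, hb]

theorem step_slide {D : Finset V} {a b : V} (hD : G.IsIndepSet (D : Set V)) (ha : a ∈ D)
    (hab : G.Adj a b) (h : ∀ y ∈ D, G.Adj b y → y = a) : Step G D (slide D a b) := by
  have hb : b ∉ D := fun hb => hD ha hb hab.ne hab
  refine ⟨hD, ?_, Or.inr ⟨a, b, ?_, ?_, hab⟩⟩
  · intro x hx y hy hxy hadj
    rw [Finset.mem_coe, mem_slide] at hx hy
    rcases hx with rfl | hx <;> rcases hy with rfl | hy
    · exact hxy rfl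
    · exact hy.1 (h y hy.2 hadj)
    · exact hx.1 (h x hx.2 hadj.symm)
    · exact hD hx.2 hy.2 hxy hadj
  · ext x
    simp only [Finset.mem_sdiff, mem_slide, Finset.mem_singleton]
    grind
  · ext x
    simp only [Finset.mem_sdiff, mem_slide, Finset.mem_singleton]
    grind [hab.ne]

theorem Step.cases_slide {D E : Finset V} (h : Step G D E) :
    E = D ∨ ∃ a b, a ∈ D ∧ b ∉ D ∧ G.Adj a b ∧ E = slide D a b := by
  obtain ⟨-, -, rfl | ⟨a, b, hab, hba, hadj⟩⟩ := h
  · exact Or.inl rfl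
  · have ha : a ∈ D \ E := by simp [hab]
    have hb : b ∈ E \ D := by simp [hba]
    rw [Finset.mem_sdiff] at ha hb
    refine Or.inr ⟨a, b, ha.1, hb.2, hadj, ?_⟩
    ext x
    have h1 : x ∈ D \ E ↔ x = a := by simp [hab]
    have h2 : x ∈ E \ D ↔ x = b := by simp [hba]
    rw [Finset.mem_sdiff] at h1 h2
    rw [mem_slide]
    grind

theorem Step.symm {D E : Finset V} (h : Step G D E) : Step G E D := by
  obtain ⟨h1, h2, rfl | ⟨a, b, hab, hba, hadj⟩⟩ := h
  · exact ⟨h1, h2, Or.inl rfl⟩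
  · exact ⟨h2, h1, Or.inr ⟨b, a, hba, hab, hadj.symm⟩⟩

theorem Reach.symm {D E : Finset V} (h : Reach G D E) : Reach G E D := by
  induction h with
  | refl => exact .refl
  | tail _ h ih => exact (Relation.ReflTransGen.single h.symm).trans ih

theorem Reach.isIndepSet {D E : Finset V} (h : Reach G D E) (hD : G.IsIndepSet (D : Set V)) :
    G.IsIndepSet (E : Set V) := by
  induction h with
  | refl => exact hD
  | tail _ h _ => exact h.2.1

theorem Reach.card_eq {D E : Finset V} (h : Reach G D E) : D.card = E.card := by
  induction h with
  | refl => rfl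
  | @tail E E' _ h ih =>
    rw [ih]
    rcases h.cases_slide with rfl | ⟨a, b, ha, hb, hab, rfl⟩
    · rfl
    · rw [slide, Finset.card_insert_of_notMem (fun h => hb (Finset.mem_of_mem_erase h)),
        Finset.card_erase_of_mem ha]
      have := Finset.card_pos.2 ⟨a, ha⟩
      omega

end Slide

theorem innerCount_add_card_sdiff (p : Arc V) (D : Finset V) :
    innerCount G p D + ((D \ inner G p).card : ℤ) = D.card := by
  rw [innerCount, Finset.inter_comm, ← Nat.cast_add, Finset.card_inter_add_card_sdiff]

/-- Slides preserve the total number of tokens, so agreement outside the interior determines the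
number inside. -/
theorem innerCount_eq_of_reach {p : Arc V} {D E : Finset V} (h : Reach G D E)
    (hout : ∀ x ∉ inner G p, x ∈ E ↔ x ∈ D) : innerCount G p E = innerCount G p D := by
  have h1 := innerCount_add_card_sdiff (G := G) p D
  have h2 := innerCount_add_card_sdiff (G := G) p E
  have h3 : D \ inner G p = E \ inner G p := by
    ext x
    simp only [Finset.mem_sdiff]
    grind
  rw [h3] at h1
  rw [h.card_eq] at h1
  omega

theorem innerCount_eq_add_one_of_reach {p : Arc V} {D E : Finset V} (h : Reach G D E)
    (hD : p.base ∈ D) (hE : p.base ∉ E)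
    (hout : ∀ x ∉ verts G p, x ∈ E ↔ x ∈ D) : innerCount G p E = innerCount G p D + 1 := by
  have h1 := innerCount_add_card_sdiff (G := G) p D
  have h2 := innerCount_add_card_sdiff (G := G) p E
  have h3 : D \ inner G p = insert p.base (E \ inner G p) := by
    ext x
    simp only [Finset.mem_sdiff, Finset.mem_insert, mem_inner]
    by_cases hx : x = p.base
    · subst hx
      simp [hD]
    · simp only [hx, not_false_eq_true, true_and, ne_eq, false_or]
      grind
  rw [h3, Finset.card_insert_of_notMem (by simp [hE]), h.card_eq] at h1
  push_cast at h1
  omega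

/-! ### Descendants in the block-tree -/

/-- `q` is reached from `p` by the recursions on the block-tree. -/
inductive Desc (G : SimpleGraph V) : Arc V → Arc V → Prop
  | refl (p : Arc V) : Desc G p p
  | bv {B : Finset V} {u v : V} {q : Arc V} :
    v ∈ kappa G B u → Desc G (.vb v B) q → Desc G (.bv B u) q
  | vb {u : V} {B B' : Finset V} {q : Arc V} :
    B' ∈ beta G u B → Desc G (.bv B' u) q → Desc G (.vb u B) q

theorem Desc.mem_arcs_and_subset (hG : IsConnectedBlockGraph G) {p q : Arc V} (h : Desc G p q)
    (hp : p ∈ arcs G) : q ∈ arcs G ∧ inner G q ⊆ inner G p := by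
  induction h with
  | refl => exact ⟨hp, subset_rfl⟩
  | bv hv _ ih =>
    obtain ⟨h1, h2⟩ := ih (vb_mem_arcs_of_mem_kappa hG hp hv)
    exact ⟨h1, h2.trans (inner_vb_subset_of_mem_kappa hG hp hv)⟩
  | vb hB _ ih =>
    obtain ⟨h1, h2⟩ := ih (bv_mem_arcs_of_mem_beta hG hp hB)
    exact ⟨h1, h2.trans (inner_bv_subset_of_mem_beta hG hp hB)⟩

/-- No weight at a descendant of `p` is smaller in `D'` than in `D`. -/
def WeightLE (hG : IsConnectedBlockGraph G) (p : Arc V) (D D' : Finset V) : Prop :=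
  ∀ q, Desc G p q → weight hG q D ≤ weight hG q D'

section WeightLE

variable {hG : IsConnectedBlockGraph G} {p : Arc V} {B : Finset V} {u : V} {D D' D'' : Finset V}

theorem WeightLE.refl : WeightLE hG p D D := fun _ _ => le_rfl

theorem WeightLE.trans (h : WeightLE hG p D D') (h' : WeightLE hG p D' D'') :
    WeightLE hG p D D'' := fun q hq => (h q hq).trans (h' q hq)

theorem WeightLE.self (h : WeightLE hG p D D') : weight hG p D ≤ weight hG p D' :=
  h p (.refl p)

theorem WeightLE.of_agree (hp : p ∈ arcs G) (h : ∀ x ∈ inner G p, x ∈ D' ↔ x ∈ D) :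
    WeightLE hG p D D' := fun q hq => by
  obtain ⟨h1, h2⟩ := hq.mem_arcs_and_subset hG hp
  exact (weight_congr hG h1 fun x hx => (h x (h2 hx)).symm).le

theorem WeightLE.bv (hp : Arc.bv B u ∈ arcs G)
    (h : ∀ v ∈ kappa G B u, WeightLE hG (.vb v B) D D') : WeightLE hG (.bv B u) D D' := by
  intro q hq
  cases hq with
  | refl =>
    rw [weight_bv hG hp, weight_bv hG hp]
    have := Finset.sum_le_sum fun v hv => (h v hv).self
    omega
  | bv hv hq => exact h _ hv q hq

theorem WeightLE.vb (h : ∀ B' ∈ beta G u B, WeightLE hG (.bv B' u) D D')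
    (hw : weight hG (.vb u B) D ≤ weight hG (.vb u B) D') : WeightLE hG (.vb u B) D D' := by
  intro q hq
  cases hq with
  | refl => exact hw
  | vb hv hq => exact h _ hv q hq

theorem linearWeight_le
    (h : ∀ B' ∈ beta G u B, weight hG (.bv B' u) D ≤ weight hG (.bv B' u) D') :
    linearWeight hG u B D ≤ linearWeight hG u B D' := by
  rw [linearWeight, linearWeight]
  have : ∀ B' ∈ beta G u B, weight hG (.bv B' u) D - uaInt hG (.bv B' u) ≤
      weight hG (.bv B' u) D' - uaInt hG (.bv B' u) := fun B' hB' =>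
    sub_le_sub_right (h B' hB') _
  have := Finset.sum_le_sum this
  omega

theorem capAt_le_of_weightLE (h : WeightLE hG p D D') (hc : innerCount G p D' = innerCount G p D) :
    capAt hG p D ≤ capAt hG p D' := by
  have := h.self
  rw [weight, weight] at this
  omega

end WeightLE

/-! ### Clearing the neighbourhood of the base, and pushing the base token inside -/

/-- The tokens inside `G[p]` can be moved away from the base whenever the capacity permits. -/
def CanClear (hG : IsConnectedBlockGraph G) (p : Arc V) : Prop :=
  ∀ D : Finset V, G.IsIndepSet (D : Set V) → uaInt hG p ≤ capAt hG p D →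
    ∃ D', Reach G D D' ∧ (∀ x ∉ inner G p, x ∈ D' ↔ x ∈ D) ∧ WeightLE hG p D D' ∧
      ∀ y ∈ inner G p, G.Adj p.base y → y ∉ D'

/-- A token on the base of `p` can be moved inside whenever the capacity is positive. -/
def CanPush (hG : IsConnectedBlockGraph G) (p : Arc V) : Prop :=
  ∀ D : Finset V, G.IsIndepSet (D : Set V) → p.base ∈ D → 1 ≤ capAt hG p D →
    ∃ D', Reach G D D' ∧ p.base ∉ D' ∧ (∀ x ∉ verts G p, x ∈ D' ↔ x ∈ D) ∧ WeightLE hG p D D'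

section Moves

variable (hG : IsConnectedBlockGraph G) {B : Finset V} {u : V}

include hG

/-- The interiors at different blocks of `u` are disjoint, so clearing one block neither spoils the
capacity needed for another nor undoes an earlier clearing. -/
theorem exists_clear_family (hu : IsCutVertex G Finset.univ u) (F : Finset (Finset V))
    (hF : F ⊆ blocksAt G Finset.univ u) (hclear : ∀ B' ∈ F, CanClear hG (.bv B' u))
    {D : Finset V} (hD : G.IsIndepSet (D : Set V))
    (hcap : ∀ B' ∈ F, uaInt hG (.bv B' u) ≤ capAt hG (.bv B' u) D) :
    ∃ D', Reach G D D' ∧ (∀ x, (∀ B' ∈ F, x ∉ inner G (.bv B' u)) → (x ∈ D' ↔ x ∈ D)) ∧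
      (∀ B' ∈ F, WeightLE hG (.bv B' u) D D' ∧
        innerCount G (.bv B' u) D' = innerCount G (.bv B' u) D ∧
        ∀ y ∈ inner G (.bv B' u), G.Adj u y → y ∉ D') := by
  induction F using Finset.induction_on with
  | empty => exact ⟨D, .refl, fun _ _ => Iff.rfl, by simp⟩
  | insert B₀ F hB₀ ih =>
    have harc : ∀ B' ∈ insert B₀ F, Arc.bv B' u ∈ arcs G := fun B' hB' =>
      mem_arcs_bv.2 ⟨hu, mem_blocksAt.1 (hF hB')⟩
    obtain ⟨D₁, hr₁, hag₁, hF₁⟩ := ih (fun x hx => hF (Finset.mem_insert_of_mem hx))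
      (fun B' hB' => hclear B' (Finset.mem_insert_of_mem hB'))
      (fun B' hB' => hcap B' (Finset.mem_insert_of_mem hB'))
    have hdisj : ∀ B' ∈ F, Disjoint (inner G (.bv B₀ u)) (inner G (.bv B' u)) := fun B' hB' =>
      disjoint_inner_bv_of_ne hG (hF (Finset.mem_insert_self _ _))
        (hF (Finset.mem_insert_of_mem hB')) (by rintro rfl; exact hB₀ hB')
    have h₀ : ∀ x ∈ inner G (.bv B₀ u), x ∈ D₁ ↔ x ∈ D := fun x hx =>
      hag₁ x fun B' hB' => Finset.disjoint_left.1 (hdisj B' hB') hx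
    have harc₀ := harc B₀ (Finset.mem_insert_self _ _)
    have hcap₀ := hcap B₀ (Finset.mem_insert_self _ _)
    rw [← capAt_congr hG harc₀ h₀] at hcap₀
    obtain ⟨D₂, hr₂, hag₂, hw₂, hc₂⟩ := hclear B₀ (Finset.mem_insert_self _ _) D₁
      (hr₁.isIndepSet hD) hcap₀
    refine ⟨D₂, hr₁.trans hr₂, ?_, ?_⟩
    · intro x hx
      rw [hag₂ x (hx B₀ (Finset.mem_insert_self _ _)),
        hag₁ x fun B' hB' => hx B' (Finset.mem_insert_of_mem hB')]
    · intro B' hB'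
      rcases Finset.mem_insert.1 hB' with rfl | hB'F
      · refine ⟨(WeightLE.of_agree harc₀ h₀).trans hw₂, ?_, hc₂⟩
        rw [innerCount_eq_of_reach hr₂ hag₂, innerCount_congr h₀]
      · have h' : ∀ x ∈ inner G (.bv B' u), x ∈ D₂ ↔ x ∈ D₁ := fun x hx =>
          hag₂ x (Finset.disjoint_right.1 (hdisj B' hB'F) hx)
        obtain ⟨h1, h2, h3⟩ := hF₁ B' hB'F
        refine ⟨h1.trans (WeightLE.of_agree (harc B' hB') h'), ?_, ?_⟩
        · rw [innerCount_congr h', h2]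
        · intro y hy hadj
          rw [h' y hy]
          exact h3 y hy hadj

/-- Excludes `B = {u}`. In `canPush_bv` this disposes of the case `κ = ∅` once every other vertex of
`B` is known to lie in `κ`. -/
theorem exists_mem_block_ne (hp : Arc.bv B u ∈ arcs G) : ∃ w ∈ B, w ≠ u := by
  obtain ⟨hcut, hB, hu⟩ := mem_arcs_bv.1 hp
  obtain ⟨y, -, hy⟩ := inner_vb_nonempty_of_isCutVertex hG hB (preconnected_induce_univ hG) hcut
  by_contra! hne
  obtain ⟨B', hB', hu', hy'⟩ := exists_block_of_adj hy
  have h1 : B ⊆ B' := fun x hx => hne x hx ▸ hu'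
  exact hy.ne' (hne y (hB.2 hB'.prop h1 hy'))

/-- Only the single token on the clique `B` can be adjacent to `u`. The spare capacity sits at some
`(v, B)`: that token is brought to `v`, if it is not already there, and pushed into `G[v, B]`. -/
theorem canClear_bv (hp : Arc.bv B u ∈ arcs G)
    (ih : ∀ v ∈ kappa G B u, CanClear hG (.vb v B) ∧ CanPush hG (.vb v B)) :
    CanClear hG (.bv B u) := by
  intro D hD hcap
  obtain ⟨-, hB, hu⟩ := mem_arcs_bv.1 hp
  by_cases hempty : ∀ x ∈ B.erase u, x ∉ D
  · exact ⟨D, .refl, fun _ _ => Iff.rfl, .refl, fun y hy hadj => hempty y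
      (Finset.mem_erase.2 ⟨hadj.ne', mem_block_of_mem_inner_bv_adj hG hB hu hy hadj⟩)⟩
  push Not at hempty
  obtain ⟨w, hw, hwD⟩ := hempty
  obtain ⟨hwu, hwB⟩ := Finset.mem_erase.1 hw
  have hwuniq : ∀ x ∈ B, x ∈ D → x = w := by
    intro x hx hxD
    by_contra hne
    exact hD hxD hwD hne (adj_of_mem_block hG hB hx hwB hne)
  -- The token on `w` costs one, so capacity at least `ua` means that the capacities of the children
  -- sum to at least one.
  obtain ⟨v, hv, hvcap⟩ : ∃ v ∈ kappa G B u, 1 ≤ capAt hG (.vb v B) D := by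
    by_contra! hne
    have h1 : 1 ≤ (B.erase u ∩ D).card := Finset.card_pos.2 ⟨w, Finset.mem_inter.2 ⟨hw, hwD⟩⟩
    have h2 : ∑ v ∈ kappa G B u, capAt hG (.vb v B) D ≤ 0 :=
      Finset.sum_nonpos fun v hv => by linarith [hne v hv]
    rw [capAt_bv hG hp] at hcap
    omega
  have harcv := vb_mem_arcs_of_mem_kappa hG hp hv
  obtain ⟨hvB, hvu, -⟩ := (mem_kappa hG hp).1 hv
  have hnotin : ∀ x ∈ B, x ∉ inner G (.vb v B) := fun x hx =>
    notMem_inner_vb_of_mem_block hG hB hvB hx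
  obtain ⟨D₁, hr₁, hag₁, hvD₁, hB₁, hw₁, hcap₁⟩ : ∃ D₁, Reach G D D₁ ∧
      (∀ x ∉ inner G (.vb v B), x ≠ w → x ≠ v → (x ∈ D₁ ↔ x ∈ D)) ∧ v ∈ D₁ ∧
      (∀ x ∈ B, x ≠ v → x ∉ D₁) ∧ WeightLE hG (.vb v B) D D₁ ∧ 1 ≤ capAt hG (.vb v B) D₁ := by
    by_cases hvw : v = w
    · subst hvw
      exact ⟨D, .refl, fun _ _ _ _ => Iff.rfl, hwD, fun x hx hne hxD => hne (hwuniq x hx hxD),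
        .refl, hvcap⟩
    · obtain ⟨D₀, hr₀, hag₀, hw₀, hc₀⟩ := (ih v hv).1 D hD ((uaInt_le_one hG _).trans hvcap)
      have hwD₀ : w ∈ D₀ := (hag₀ w (hnotin w hwB)).2 hwD
      have hst : Step G D₀ (slide D₀ w v) := by
        refine step_slide (hr₀.isIndepSet hD) hwD₀
          (adj_of_mem_block hG hB hwB hvB (Ne.symm hvw)) ?_
        intro y hy hadj
        by_cases hyB : y ∈ B
        · exact hwuniq y hyB ((hag₀ y (hnotin y hyB)).1 hy)
        · exact absurd hy (hc₀ y (mem_inner_vb_of_adj hadj hyB) hadj)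
      have hag' : ∀ x ∈ inner G (.vb v B), x ∈ slide D₀ w v ↔ x ∈ D₀ := fun x hx =>
        mem_slide_of_ne (by rintro rfl; exact hnotin _ hwB hx) (by rintro rfl; exact hnotin _ hvB hx)
      refine ⟨slide D₀ w v, hr₀.tail hst, ?_, ?_, ?_, ?_, ?_⟩
      · intro x hx hxw hxv
        rw [mem_slide_of_ne hxw hxv, hag₀ x hx]
      · exact mem_slide.2 (Or.inl rfl)
      · intro x hx hxv hxs
        rcases mem_slide.1 hxs with h | ⟨h1, h2⟩
        · exact hxv h
        · exact h1 (hwuniq x hx ((hag₀ x (hnotin x hx)).1 h2))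
      · exact hw₀.trans (WeightLE.of_agree harcv hag')
      · rw [capAt_congr hG harcv hag']
        exact hvcap.trans (capAt_le_of_weightLE hw₀ (innerCount_eq_of_reach hr₀ hag₀))
  obtain ⟨D₂, hr₂, hvD₂, hag₂, hw₂⟩ := (ih v hv).2 D₁ (hr₁.isIndepSet hD) hvD₁ hcap₁
  have hvsub := verts_vb_subset_of_mem_kappa hG hp hv
  refine ⟨D₂, hr₁.trans hr₂, ?_, WeightLE.bv hp fun v' hv' => ?_, ?_⟩
  · intro x hx
    have hxv : x ∉ verts G (.vb v B) := fun h => hx (hvsub h)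
    rw [hag₂ x hxv]
    refine hag₁ x (fun h => hxv (mem_inner.1 h).2) ?_ ?_
    · rintro rfl
      exact hx (block_sdiff_subset_inner_bv hG hB hu hw)
    · rintro rfl
      exact hxv (base_mem_verts G (.vb x B))
  · by_cases hvv : v' = v
    · subst hvv
      exact hw₁.trans hw₂
    · obtain ⟨hvB', -, -⟩ := (mem_kappa hG hp).1 hv'
      refine WeightLE.of_agree (vb_mem_arcs_of_mem_kappa hG hp hv') fun x hx => ?_
      have hxv : x ∉ verts G (.vb v B) :=
        Finset.disjoint_left.1 (verts_vb_disjoint hG hB hvB' hvB hvv) (mem_inner.1 hx).2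
      have hxB : x ∉ B := fun h => notMem_inner_vb_of_mem_block hG hB hvB' h hx
      rw [hag₂ x hxv]
      refine hag₁ x (fun h => hxv (mem_inner.1 h).2) ?_ ?_
      · rintro rfl
        exact hxB hwB
      · rintro rfl
        exact hxB hvB
  · intro y hy hadj
    have hyB := mem_block_of_mem_inner_bv_adj hG hB hu hy hadj
    by_cases hyv : y = v
    · subst hyv
      exact hvD₂
    · rw [hag₂ y (not_mem_verts_of_mem_block hB (hG.isClique B hB) hyB hvB hyv)]
      exact hB₁ y hyB hyv

/-- With `u` occupied, `B` carries no other token. A vertex of `B` outside `κ` has neighbours only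
in `B` and can receive the token at once; otherwise the neighbourhood of some `v` in `κ` is cleared
first. -/
theorem canPush_bv (hp : Arc.bv B u ∈ arcs G) (ih : ∀ v ∈ kappa G B u, CanClear hG (.vb v B)) :
    CanPush hG (.bv B u) := by
  intro D hD huD hcap
  obtain ⟨-, hB, hu⟩ := mem_arcs_bv.1 hp
  have huD : u ∈ D := huD
  have hBD : ∀ x ∈ B, x ≠ u → x ∉ D := fun x hx hxu hxD =>
    hD hxD huD hxu (adj_of_mem_block hG hB hx hu hxu)
  have huv : u ∈ verts G (.bv B u) := base_mem_verts G (.bv B u)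
  have hbv : ∀ x ∈ B, x ∈ verts G (.bv B u) := fun x hx => by
    by_cases hxu : x = u
    · exact hxu ▸ huv
    · exact (mem_inner.1 (block_sdiff_subset_inner_bv hG hB hu
        (Finset.mem_erase.2 ⟨hxu, hx⟩))).2
  by_cases hall : ∃ w ∈ B, w ≠ u ∧ w ∉ kappa G B u
  · obtain ⟨w, hwB, hwu, hwκ⟩ := hall
    have hst : Step G D (slide D u w) := by
      refine step_slide hD huD (adj_of_mem_block hG hB hu hwB hwu.symm) ?_
      intro y hy hadj
      by_contra hyu
      by_cases hyB : y ∈ B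
      · exact hBD y hyB hyu hy
      · exact hwκ ((mem_kappa hG hp).2 ⟨hwB, hwu, y, mem_inner_vb_of_adj hadj hyB⟩)
    refine ⟨slide D u w, .single hst, ?_, ?_, WeightLE.bv hp fun v hv => ?_⟩
    · simp only [Arc.base, mem_slide, ne_eq, not_true_eq_false, false_and, or_false]
      exact hwu.symm
    · intro x hx
      exact mem_slide_of_ne (by rintro rfl; exact hx huv) (by rintro rfl; exact hx (hbv _ hwB))
    · obtain ⟨hvB, -, -⟩ := (mem_kappa hG hp).1 hv
      refine WeightLE.of_agree (vb_mem_arcs_of_mem_kappa hG hp hv) fun x hx => ?_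
      have hxB : x ∉ B := fun h => notMem_inner_vb_of_mem_block hG hB hvB h hx
      exact mem_slide_of_ne (by rintro rfl; exact hxB hu) (by rintro rfl; exact hxB hwB)
  push Not at hall
  -- If no `v` could be cleared, every child would have capacity zero and true `ua`. As `B = κ ∪
  -- {u}`, `ua` would fail at `(B, u)`, leaving its capacity below one.
  obtain ⟨v, hv, hvcap⟩ : ∃ v ∈ kappa G B u, uaInt hG (.vb v B) ≤ capAt hG (.vb v B) D := by
    by_contra! hne
    have hcap0 : ∀ v ∈ kappa G B u, capAt hG (.vb v B) D ≤ 0 := fun v hv => by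
      linarith [hne v hv, uaInt_le_one hG (.vb v B)]
    have h2 := Finset.sum_nonpos hcap0
    rw [capAt_bv hG hp] at hcap
    have hua : ua hG (.bv B u) := by
      by_contra h
      rw [uaInt_of_not_ua h] at hcap
      omega
    rw [ua_bv hG hp] at hua
    obtain ⟨w, hw, hwu⟩ := exists_mem_block_ne hG hp
    rcases hua with h | h
    · have := hall w hw hwu
      simp [h] at this
    · refine h ⟨fun v hv => ?_, ?_⟩
      · by_contra hv'
        have h3 := hne v hv
        rw [uaInt_of_not_ua hv'] at h3
        linarith [capAt_nonneg hG hD (vb_mem_arcs_of_mem_kappa hG hp hv)]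
      · ext x
        simp only [Finset.mem_union, Finset.mem_singleton]
        constructor
        · intro hx
          by_cases hxu : x = u
          · exact Or.inr hxu
          · exact Or.inl (hall x hx hxu)
        · rintro (hx | rfl)
          · exact ((mem_kappa hG hp).1 hx).1
          · exact hu
  have harcv := vb_mem_arcs_of_mem_kappa hG hp hv
  obtain ⟨hvB, hvu, -⟩ := (mem_kappa hG hp).1 hv
  obtain ⟨D₀, hr₀, hag₀, hw₀, hc₀⟩ := ih v hv D hD hvcap
  have hnotin : ∀ x ∈ B, x ∉ inner G (.vb v B) := fun x hx =>
    notMem_inner_vb_of_mem_block hG hB hvB hx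
  have hst : Step G D₀ (slide D₀ u v) := by
    refine step_slide (hr₀.isIndepSet hD) ((hag₀ u (hnotin u hu)).2 huD)
      (adj_of_mem_block hG hB hu hvB hvu.symm) ?_
    intro y hy hadj
    by_contra hyu
    by_cases hyB : y ∈ B
    · exact hBD y hyB hyu ((hag₀ y (hnotin y hyB)).1 hy)
    · exact hc₀ y (mem_inner_vb_of_adj hadj hyB) hadj hy
  have hslide : ∀ x, x ∉ B → (x ∈ slide D₀ u v ↔ x ∈ D₀) := fun x hx =>
    mem_slide_of_ne (by rintro rfl; exact hx hu) (by rintro rfl; exact hx hvB)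
  refine ⟨slide D₀ u v, hr₀.tail hst, ?_, ?_, WeightLE.bv hp fun v' hv' => ?_⟩
  · simp only [Arc.base, mem_slide, ne_eq, not_true_eq_false, false_and, or_false]
    exact hvu.symm
  · intro x hx
    rw [hslide x fun h => hx (hbv x h), hag₀]
    exact fun h => hx (mem_inner.1 (inner_vb_subset_of_mem_kappa hG hp hv h)).2
  · obtain ⟨hvB', -, -⟩ := (mem_kappa hG hp).1 hv'
    have hag : WeightLE hG (.vb v' B) D₀ (slide D₀ u v) :=
      WeightLE.of_agree (vb_mem_arcs_of_mem_kappa hG hp hv') fun x hx =>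
        hslide x fun h => notMem_inner_vb_of_mem_block hG hB hvB' h hx
    by_cases hvv : v' = v
    · subst hvv
      exact hw₀.trans hag
    · refine WeightLE.trans (WeightLE.of_agree (vb_mem_arcs_of_mem_kappa hG hp hv')
        fun x hx => hag₀ x ?_) hag
      exact Finset.disjoint_left.1 (disjoint_inner_vb_of_ne hG hp hvB' hvB hvv) hx

theorem canClear_vb (hp : Arc.vb u B ∈ arcs G) (ih : ∀ B' ∈ beta G u B, CanClear hG (.bv B' u)) :
    CanClear hG (.vb u B) := by
  intro D hD hcap
  have hun : ∀ B' ∈ beta G u B, uaInt hG (.bv B' u) ≤ capAt hG (.bv B' u) D := by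
    intro B' hB'
    refine uaInt_le_capAt_of_not_blocked hG hD (bv_mem_arcs_of_mem_beta hG hp hB') ?_
    rintro ⟨h0, hua⟩
    rw [capAt_vb_of_blocked hG hp hB' h0 hua, uaInt_vb_of_mem_beta hG hB' hua] at hcap
    omega
  obtain ⟨D', hr, hag, hF⟩ := exists_clear_family hG (mem_arcs_vb.1 hp).1 (beta G u B)
    (fun B' hB' => ((mem_beta hG hp).1 hB').1) ih hD hun
  refine ⟨D', hr, ?_, WeightLE.vb (fun B' hB' => (hF B' hB').1) ?_, ?_⟩
  · intro x hx
    exact hag x fun B' hB' h => hx (inner_bv_subset_of_mem_beta hG hp hB' h)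
  · rw [weight_vb_of_unblocked hG hp hun, weight_vb_of_unblocked hG hp fun B' hB' =>
      (hun B' hB').trans (capAt_le_of_weightLE (hF B' hB').1 (hF B' hB').2.1)]
    exact linearWeight_le fun B' hB' => (hF B' hB').1.self
  · intro y hy hadj
    obtain ⟨B', hB', hy'⟩ := exists_mem_inner_bv_of_mem_inner_vb hG hp hy
    exact (hF B' hB').2.2 y hy' hadj

theorem canPush_vb (hp : Arc.vb u B ∈ arcs G) (ih : ∀ B' ∈ beta G u B, CanPush hG (.bv B' u)) :
    CanPush hG (.vb u B) := by
  intro D hD huD hcap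
  have hun : ∀ B' ∈ beta G u B, uaInt hG (.bv B' u) ≤ capAt hG (.bv B' u) D := fun B' hB' =>
    uaInt_le_capAt hG hD (bv_mem_arcs_of_mem_beta hG hp hB') huD
  -- A block with capacity above `ua` is preferred, because it does not become blocking when it
  -- receives a token. If there is none, every summand vanishes and the capacity at `(u, B)` is at
  -- most one, so the extra inner token makes up for its loss.
  obtain ⟨B₁, hB₁, hcap₁, hor⟩ : ∃ B₁ ∈ beta G u B, 1 ≤ capAt hG (.bv B₁ u) D ∧
      (uaInt hG (.bv B₁ u) + 1 ≤ capAt hG (.bv B₁ u) D ∨ capAt hG (.vb u B) D ≤ 1) := by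
    by_cases h : ∃ B₁ ∈ beta G u B, uaInt hG (.bv B₁ u) + 1 ≤ capAt hG (.bv B₁ u) D
    · obtain ⟨B₁, hB₁, h⟩ := h
      exact ⟨B₁, hB₁, by linarith [uaInt_nonneg hG (.bv B₁ u)], Or.inl h⟩
    · push Not at h
      have hsum : ∑ B' ∈ beta G u B, (capAt hG (.bv B' u) D - uaInt hG (.bv B' u)) ≤ 0 :=
        Finset.sum_nonpos fun B' hB' => by have := h B' hB'; omega
      have hle1 := uaInt_le_one hG (.vb u B)
      have heq := capAt_vb_of_unblocked hG hp hun
      have hua : ua hG (.vb u B) := by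
        by_contra hua
        rw [uaInt_of_not_ua hua] at heq
        omega
      obtain ⟨B', hB', hua'⟩ := (ua_vb hG B u).1 hua
      have := hun B' hB'
      rw [uaInt_of_ua hua'] at this
      exact ⟨B', hB', this, Or.inr (by omega)⟩
  obtain ⟨D', hr, huD', hag, hw⟩ := ih B₁ hB₁ D hD huD hcap₁
  have hin : ∀ B' ∈ beta G u B, B' ≠ B₁ → ∀ x ∈ inner G (.bv B' u), x ∈ D' ↔ x ∈ D := by
    intro B' hB' hne x hx
    refine hag x fun h => ?_
    exact Finset.disjoint_left.1 (disjoint_inner_bv_of_ne hG ((mem_beta hG hp).1 hB').1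
      ((mem_beta hG hp).1 hB₁).1 hne) hx (mem_inner.2 ⟨(mem_inner.1 hx).1, h⟩)
  have hle : ∀ B' ∈ beta G u B, WeightLE hG (.bv B' u) D D' := by
    intro B' hB'
    by_cases hne : B' = B₁
    · subst hne
      exact hw
    · exact WeightLE.of_agree (bv_mem_arcs_of_mem_beta hG hp hB') (hin B' hB' hne)
  have hag' : ∀ x ∉ verts G (.vb u B), x ∈ D' ↔ x ∈ D := by
    intro x hx
    refine hag x fun h => hx ?_
    rcases mem_verts_iff.1 h with h | h
    · exact h ▸ base_mem_verts G (.vb u B)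
    · exact (mem_inner.1 (inner_bv_subset_of_mem_beta hG hp hB₁ h)).2
  refine ⟨D', hr, huD', hag', WeightLE.vb hle ?_⟩
  have hD' := hr.isIndepSet hD
  by_cases hb : ∃ B' ∈ beta G u B, capAt hG (.bv B' u) D' = 0 ∧ ua hG (.bv B' u)
  · obtain ⟨B', hB', h0, hua⟩ := hb
    have hc := hun B' hB'
    rw [uaInt_of_ua hua] at hc
    -- The other blocks are untouched and did not block before, so only the block that received the
    -- token can block now.
    have hBB : B' = B₁ := by
      by_contra hne
      rw [capAt_congr hG (bv_mem_arcs_of_mem_beta hG hp hB') (hin B' hB' hne)] at h0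
      omega
    subst hBB
    have h1 := innerCount_eq_add_one_of_reach (p := .bv B' u) hr huD huD' hag
    have h2 := hw.self
    have h3 := innerCount_eq_add_one_of_reach (p := .vb u B) hr huD huD' hag'
    have h4 := capAt_nonneg hG hD' hp
    rw [uaInt_of_ua hua] at hor
    simp only [weight] at h2 ⊢
    omega
  · push Not at hb
    rw [weight_vb_of_unblocked hG hp hun, weight_vb_of_unblocked hG hp fun B' hB' =>
      uaInt_le_capAt_of_not_blocked hG hD' (bv_mem_arcs_of_mem_beta hG hp hB')
        fun h => hb B' hB' h.1 h.2]
    exact linearWeight_le fun B' hB' => (hle B' hB').self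

theorem canClear_and_canPush : ∀ p ∈ arcs G, CanClear hG p ∧ CanPush hG p :=
  arc_induction hG
    (fun _ _ hp ih => ⟨canClear_bv hG hp ih, canPush_bv hG hp fun v hv => (ih v hv).1⟩)
    (fun _ _ hp ih => ⟨canClear_vb hG hp fun v hv => (ih v hv).1,
      canPush_vb hG hp fun v hv => (ih v hv).2⟩)

end Moves

/-! ### Cut-vertices that never carry a token -/

/-- Every edge between the interior and the rest of the graph ends at the base, so a slide that
changes the inner count uses the base. -/
theorem innerCount_eq_of_step {p : Arc V} {D E : Finset V} (h : Step G D E) (hD : p.base ∉ D)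
    (hE : p.base ∉ E) : innerCount G p E = innerCount G p D := by
  rcases h.cases_slide with rfl | ⟨a, b, ha, -, hab, rfl⟩
  · rfl
  have hap : a ≠ p.base := by rintro rfl; exact hD ha
  have hbp : b ≠ p.base := by rintro rfl; exact hE (mem_slide.2 (Or.inl rfl))
  by_cases hin : a ∈ inner G p
  · have hb := mem_inner_of_mem_inner_adj hin hab hbp
    exact innerCount_eq_of_reach (.single h) fun x hx =>
      mem_slide_of_ne (by rintro rfl; exact hx hin) (by rintro rfl; exact hx hb)
  · have hb : b ∉ inner G p := fun hb => hin (mem_inner_of_mem_inner_adj hb hab.symm hap)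
    exact innerCount_congr fun x hx =>
      mem_slide_of_ne (by rintro rfl; exact hin hx) (by rintro rfl; exact hb hx)

/-- If the base of `p` never carries a token, then the number of tokens inside is constant. -/
theorem innerCount_eq_of_base_never_mem {p : Arc V} {D E : Finset V}
    (h : ∀ E, Reach G D E → p.base ∉ E) (hE : Reach G D E) :
    innerCount G p E = innerCount G p D := by
  induction hE with
  | refl => rfl
  | tail hr hst ih => rw [innerCount_eq_of_step hst (h _ hr) (h _ (hr.tail hst)), ih]

section Frozen

variable (hG : IsConnectedBlockGraph G) {B B₁ B₂ : Finset V} {u : V} {C D E : Finset V}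

/-- No set reachable from `C` gives `(B, u)` a larger weight than the number of inner tokens of `C`,
and `ua` holds at `(B, u)`. -/
def Saturated (C B : Finset V) (u : V) : Prop :=
  ua hG (.bv B u) ∧ ∀ E, Reach G C E → weight hG (.bv B u) E ≤ innerCount G (.bv B u) C

/-- Two different blocks at `u` are saturated. -/
def Frozen (C : Finset V) (u : V) : Prop :=
  ∃ B₁ ∈ blocksAt G Finset.univ u, ∃ B₂ ∈ blocksAt G Finset.univ u, B₁ ≠ B₂ ∧
    Saturated hG C B₁ u ∧ Saturated hG C B₂ u

variable {hG}

/-- The first token to reach `u` comes from the interior of at most one of the two saturated blocks.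
The other keeps its inner count, so its capacity is still zero, whereas an occupied base requires
capacity at least `ua = 1`. -/
theorem Frozen.notMem (hu : IsCutVertex G Finset.univ u) (hC : G.IsIndepSet (C : Set V))
    (h : Frozen hG C u) (hE : Reach G C E) : u ∉ E := by
  obtain ⟨B₁, h₁, B₂, h₂, hne, ⟨hua₁, hw₁⟩, hua₂, hw₂⟩ := h
  have hdisj := disjoint_inner_bv_of_ne hG h₁ h₂ hne
  rw [mem_blocksAt] at h₁ h₂
  have harc₁ : Arc.bv B₁ u ∈ arcs G := mem_arcs_bv.2 ⟨hu, h₁⟩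
  have harc₂ : Arc.bv B₂ u ∈ arcs G := mem_arcs_bv.2 ⟨hu, h₂⟩
  have key : ∀ B, Arc.bv B u ∈ arcs G → ua hG (.bv B u) → ∀ E, Reach G C E →
      weight hG (.bv B u) E ≤ innerCount G (.bv B u) C →
      innerCount G (.bv B u) E = innerCount G (.bv B u) C → u ∉ E := by
    intro B harc hua E hE hw hc huE
    have := uaInt_le_capAt hG (hE.isIndepSet hC) harc huE
    rw [uaInt_of_ua hua] at this
    rw [weight] at hw
    omega
  suffices u ∉ E ∧ innerCount G (.bv B₁ u) E = innerCount G (.bv B₁ u) C ∧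
      innerCount G (.bv B₂ u) E = innerCount G (.bv B₂ u) C from this.1
  induction hE with
  | refl => exact ⟨key B₁ harc₁ hua₁ _ .refl (hw₁ _ .refl) rfl, rfl, rfl⟩
  | @tail E E' hr hst ih =>
    obtain ⟨huE, hc₁, hc₂⟩ := ih
    have hr' := hr.tail hst
    have huE' : u ∉ E' := by
      intro huE'
      rcases hst.cases_slide with rfl | ⟨a, b, ha, -, hab, rfl⟩
      · exact huE huE'
      · have hbu : b = u := by
          rcases mem_slide.1 huE' with h | h
          · exact h.symm
          · exact absurd h.2 huE
        subst hbu
        have hcount : ∀ B, a ∉ inner G (.bv B b) →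
            innerCount G (.bv B b) (slide E a b) = innerCount G (.bv B b) E := fun B haB =>
          innerCount_congr fun x hx =>
            mem_slide_of_ne (by rintro rfl; exact haB hx) (mem_inner.1 hx).1
        by_cases ha₁ : a ∈ inner G (.bv B₁ b)
        · exact key B₂ harc₂ hua₂ _ hr' (hw₂ _ hr')
            (by rw [hcount B₂ (Finset.disjoint_left.1 hdisj ha₁), hc₂]) huE'
        · exact key B₁ harc₁ hua₁ _ hr' (hw₁ _ hr') (by rw [hcount B₁ ha₁, hc₁]) huE'
    exact ⟨huE', (innerCount_eq_of_step (p := .bv B₁ u) hst huE huE').trans hc₁,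
      (innerCount_eq_of_step (p := .bv B₂ u) hst huE huE').trans hc₂⟩

theorem Frozen.innerCount_eq (hu : IsCutVertex G Finset.univ u) (hC : G.IsIndepSet (C : Set V))
    (h : Frozen hG C u) {p : Arc V} (hp : p.base = u) (hE : Reach G C E) :
    innerCount G p E = innerCount G p C :=
  innerCount_eq_of_base_never_mem (fun _ hF => hp ▸ h.notMem hu hC hF) hE

theorem Saturated.capAt_eq_zero (hC : G.IsIndepSet (C : Set V)) (hp : Arc.bv B u ∈ arcs G)
    (h : Saturated hG C B u) (hE : Reach G C E)
    (hc : innerCount G (.bv B u) E = innerCount G (.bv B u) C) :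
    capAt hG (.bv B u) E = 0 := by
  have h1 := h.2 E hE
  have h2 := capAt_nonneg hG (hE.isIndepSet hC) hp
  rw [weight] at h1
  omega

/-- Saturation transfers along slides that keep the number of inner tokens. -/
theorem Saturated.of_reach (h : Saturated hG D B u) (hr : Reach G C D)
    (hc : innerCount G (.bv B u) D = innerCount G (.bv B u) C) : Saturated hG C B u :=
  ⟨h.1, fun E hE => hc ▸ h.2 E (hr.symm.trans hE)⟩

/-- At least one of the two saturated blocks differs from `B`. It blocks `u` in every reachable set,
so the capacity stays zero and the weight is the constant inner count. -/
theorem weight_vb_of_frozen (hp : Arc.vb u B ∈ arcs G) (hC : G.IsIndepSet (C : Set V))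
    (h : Frozen hG C u) (hE : Reach G C E) :
    weight hG (.vb u B) E = innerCount G (.vb u B) C := by
  have hu := (mem_arcs_vb.1 hp).1
  have hcount : ∀ p : Arc V, p.base = u → innerCount G p E = innerCount G p C := fun p hpu =>
    h.innerCount_eq hu hC hpu hE
  suffices ∃ B' ∈ beta G u B, Saturated hG C B' u by
    obtain ⟨B', hB', hs⟩ := this
    rw [weight, capAt_vb_of_blocked hG hp hB' (hs.capAt_eq_zero hC
      (bv_mem_arcs_of_mem_beta hG hp hB') hE (hcount _ rfl)) hs.1, hcount _ rfl, zero_add]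
  obtain ⟨B₁, h₁, B₂, h₂, hne, hs₁, hs₂⟩ := h
  by_cases hB : B₁ = B
  · exact ⟨B₂, (mem_beta hG hp).2 ⟨h₂, fun h => hne (hB.trans h.symm)⟩, hs₂⟩
  · exact ⟨B₁, (mem_beta hG hp).2 ⟨h₁, hB⟩, hs₁⟩

end Frozen

/-! ### Optimal sets -/

theorem sum_le_sum_add_of_subsingleton {ι : Type*} [DecidableEq ι] {s : Finset ι} {f g : ι → ℤ}
    {c : ℤ} {T : ι → Prop} (hc : 0 ≤ c) (h₁ : ∀ i ∈ s, ¬ T i → f i ≤ g i)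
    (h₂ : ∀ i ∈ s, T i → f i ≤ g i + 1 ∧ 1 ≤ c)
    (h₃ : ∀ i ∈ s, ∀ j ∈ s, T i → T j → i = j) : ∑ i ∈ s, f i ≤ ∑ i ∈ s, g i + c := by
  by_cases h : ∃ i ∈ s, T i
  · obtain ⟨i, hi, hT⟩ := h
    rw [← Finset.add_sum_erase s f hi, ← Finset.add_sum_erase s g hi]
    have := h₂ i hi hT
    have : ∑ j ∈ s.erase i, f j ≤ ∑ j ∈ s.erase i, g j :=
      Finset.sum_le_sum fun j hj => by
        obtain ⟨hji, hj⟩ := Finset.mem_erase.1 hj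
        exact h₁ j hj fun hT' => hji (h₃ j hj i hi hT' hT)
    omega
  · push Not at h
    have := Finset.sum_le_sum fun i hi => h₁ i hi (h i hi)
    omega

/-- `D` is reachable from `C` and has the largest weight at all descendants of `p`. -/
def Optimal (hG : IsConnectedBlockGraph G) (C : Finset V) (p : Arc V) (D : Finset V) : Prop :=
  Reach G C D ∧ ∀ E, Reach G C E → WeightLE hG p E D

/-- A token inside `G[p]` can be moved to the base whenever this is not prevented by the number of
inner tokens or by the tokens outside. -/
def CanPull (hG : IsConnectedBlockGraph G) (C : Finset V) (p : Arc V) : Prop :=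
  ∀ D : Finset V, Optimal hG C p D →
    (∃ E, Reach G C E ∧ innerCount G p E < innerCount G p D) → p.base ∉ D →
    (∀ y ∈ D, G.Adj p.base y → y ∈ inner G p) →
    ∃ D', Reach G D D' ∧ p.base ∈ D' ∧ (∀ x ∉ verts G p, x ∈ D' ↔ x ∈ D) ∧ WeightLE hG p D D'

section Optimal

variable {hG : IsConnectedBlockGraph G} {B : Finset V} {u v : V} {C D D' E : Finset V} {p : Arc V}

theorem Optimal.of_weightLE (h : Optimal hG C p D) (hr : Reach G D D')
    (hw : WeightLE hG p D D') : Optimal hG C p D' :=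
  ⟨h.1.trans hr, fun E hE => (h.2 E hE).trans hw⟩

theorem Optimal.bv_child (h : Optimal hG C (.bv B u) D) (hv : v ∈ kappa G B u) :
    Optimal hG C (.vb v B) D :=
  ⟨h.1, fun E hE q hq => h.2 E hE q (.bv hv hq)⟩

theorem Optimal.vb_child {B' : Finset V} (h : Optimal hG C (.vb u B) D) (hB' : B' ∈ beta G u B) :
    Optimal hG C (.bv B' u) D :=
  ⟨h.1, fun E hE q hq => h.2 E hE q (.vb hB' hq)⟩

/-- In a blocked set the weight is the sum of the inner counts. A summand exceeds its linear
counterpart only if its block blocks and already has the weight it has in `D'`, and then by one. At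
most one block does so, and the term `uaInt` at `(u, B)` absorbs that excess. -/
theorem weight_vb_le_linearWeight (hp : Arc.vb u B ∈ arcs G) (hD : G.IsIndepSet (D : Set V))
    (hw : ∀ B' ∈ beta G u B, weight hG (.bv B' u) D ≤ weight hG (.bv B' u) D')
    (hone : ∀ B₁ ∈ beta G u B, ∀ B₂ ∈ beta G u B,
      (capAt hG (.bv B₁ u) D = 0 ∧ ua hG (.bv B₁ u) ∧
        weight hG (.bv B₁ u) D = weight hG (.bv B₁ u) D') →
      (capAt hG (.bv B₂ u) D = 0 ∧ ua hG (.bv B₂ u) ∧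
        weight hG (.bv B₂ u) D = weight hG (.bv B₂ u) D') → B₁ = B₂) :
    weight hG (.vb u B) D ≤ linearWeight hG u B D' := by
  by_cases hb : ∃ B' ∈ beta G u B, capAt hG (.bv B' u) D = 0 ∧ ua hG (.bv B' u)
  · obtain ⟨B', hB', h0, hua⟩ := hb
    rw [weight, capAt_vb_of_blocked hG hp hB' h0 hua, zero_add, innerCount_vb hG hp, linearWeight]
    refine sum_le_sum_add_of_subsingleton (uaInt_nonneg hG _) ?_ ?_ hone
    · intro B₁ hB₁ hT
      have h1 := hw B₁ hB₁
      have h2 := capAt_nonneg hG hD (bv_mem_arcs_of_mem_beta hG hp hB₁)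
      have h3 : weight hG (.bv B₁ u) D = capAt hG (.bv B₁ u) D + innerCount G (.bv B₁ u) D := rfl
      by_cases hua₁ : ua hG (.bv B₁ u)
      · rw [uaInt_of_ua hua₁]
        by_cases h0 : capAt hG (.bv B₁ u) D = 0
        · have : weight hG (.bv B₁ u) D ≠ weight hG (.bv B₁ u) D' := fun h => hT ⟨h0, hua₁, h⟩
          omega
        · omega
      · rw [uaInt_of_not_ua hua₁]
        omega
    · intro B₁ hB₁ hT
      have h1 := hw B₁ hB₁
      have h3 : weight hG (.bv B₁ u) D = capAt hG (.bv B₁ u) D + innerCount G (.bv B₁ u) D := rfl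
      rw [uaInt_of_ua hT.2.1, uaInt_vb_of_mem_beta hG hB₁ hT.2.1]
      have := hT.1
      constructor <;> omega
  · push Not at hb
    rw [weight_vb_of_unblocked hG hp fun B' hB' => uaInt_le_capAt_of_not_blocked hG hD
      (bv_mem_arcs_of_mem_beta hG hp hB') fun h => hb B' hB' h.1 h.2]
    exact linearWeight_le hw

theorem step_slide_to_base (hp : Arc.bv B u ∈ arcs G) (hD : G.IsIndepSet (D : Set V)) {w : V}
    (hw : w ∈ B.erase u) (hwD : w ∈ D) (hout : ∀ y ∈ D, G.Adj u y → y ∈ inner G (.bv B u)) :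
    Step G D (slide D w u) ∧ WeightLE hG (.bv B u) D (slide D w u) := by
  obtain ⟨-, hB, hu⟩ := mem_arcs_bv.1 hp
  obtain ⟨hwu, hwB⟩ := Finset.mem_erase.1 hw
  refine ⟨step_slide hD hwD (adj_of_mem_block hG hB hwB hu hwu) ?_, WeightLE.bv hp fun v hv => ?_⟩
  · intro y hy hadj
    have hyB := mem_block_of_mem_inner_bv_adj hG hB hu (hout y hy hadj) hadj
    by_contra hne
    exact hD hy hwD hne (adj_of_mem_block hG hB hyB hwB hne)
  · refine WeightLE.of_agree (vb_mem_arcs_of_mem_kappa hG hp hv) fun x hx => ?_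
    have hxB : x ∉ B := fun h =>
      notMem_inner_vb_of_mem_block hG hB ((mem_kappa hG hp).1 hv).1 h hx
    exact mem_slide_of_ne (by rintro rfl; exact hxB hwB) (by rintro rfl; exact hxB hu)

/-- A token on `B` slides straight to `u`. If `B` is empty, the inner count is the sum over the
children, so some child can lose a token; that token is pulled to its base `v` in `B` and then slid
to `u`. -/
theorem canPull_bv (hC : G.IsIndepSet (C : Set V)) (hp : Arc.bv B u ∈ arcs G)
    (ih : ∀ v ∈ kappa G B u, CanPull hG C (.vb v B)) : CanPull hG C (.bv B u) := by
  rintro D hopt ⟨E, hE, hlt⟩ huD hout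
  obtain ⟨-, hB, hu⟩ := mem_arcs_bv.1 hp
  have huD : u ∉ D := huD
  have hout : ∀ y ∈ D, G.Adj u y → y ∈ inner G (.bv B u) := hout
  have hD := hopt.1.isIndepSet hC
  by_cases hex : ∃ w ∈ B.erase u, w ∈ D
  · obtain ⟨w, hw, hwD⟩ := hex
    obtain ⟨hst, hle⟩ := step_slide_to_base (hG := hG) hp hD hw hwD hout
    refine ⟨slide D w u, .single hst, mem_slide.2 (Or.inl rfl), fun x hx => ?_, hle⟩
    refine mem_slide_of_ne ?_ ?_
    · rintro rfl
      exact hx (mem_inner.1 (block_sdiff_subset_inner_bv hG hB hu hw)).2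
    · rintro rfl
      exact hx (base_mem_verts G (.bv B x))
  push Not at hex
  have hBD : ∀ x ∈ B, x ∉ D := fun x hx hxD => by
    by_cases hxu : x = u
    · exact huD (hxu ▸ hxD)
    · exact hex x (Finset.mem_erase.2 ⟨hxu, hx⟩) hxD
  obtain ⟨v, hv, hlt'⟩ : ∃ v ∈ kappa G B u, innerCount G (.vb v B) E < innerCount G (.vb v B) D := by
    refine Finset.exists_lt_of_sum_lt ?_
    rw [innerCount_bv hG hp, innerCount_bv hG hp] at hlt
    have h0 : B.erase u ∩ D = ∅ := by
      ext x
      simp only [Finset.mem_inter, Finset.notMem_empty, iff_false, not_and]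
      exact hex x
    rw [h0, Finset.card_empty] at hlt
    omega
  have harcv := vb_mem_arcs_of_mem_kappa hG hp hv
  obtain ⟨hvB, hvu, -⟩ := (mem_kappa hG hp).1 hv
  obtain ⟨D₁, hr₁, hvD₁, hag₁, hw₁⟩ := ih v hv D (hopt.bv_child hv) ⟨E, hE, hlt'⟩ (hBD v hvB)
    fun y hy hadj => mem_inner_vb_of_adj hadj fun hyB => hBD y hyB hy
  have hvD₁ : v ∈ D₁ := hvD₁
  have hnot : ∀ x ∈ B, x ≠ v → x ∉ verts G (.vb v B) := fun x hx hxv =>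
    not_mem_verts_of_mem_block hB (hG.isClique B hB) hx hvB hxv
  have hout₁ : ∀ y ∈ D₁, G.Adj u y → y ∈ inner G (.bv B u) := by
    intro y hy hadj
    by_cases hyv : y ∈ verts G (.vb v B)
    · exact verts_vb_subset_of_mem_kappa hG hp hv hyv
    · exact hout y ((hag₁ y hyv).1 hy) hadj
  obtain ⟨hst, hle⟩ := step_slide_to_base (hG := hG) hp (hr₁.isIndepSet hD)
    (Finset.mem_erase.2 ⟨hvu, hvB⟩) hvD₁ hout₁
  refine ⟨slide D₁ v u, hr₁.tail hst, mem_slide.2 (Or.inl rfl), fun x hx => ?_,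
    (WeightLE.bv hp fun v' hv' => ?_).trans hle⟩
  · have hxv : x ∉ verts G (.vb v B) := fun h =>
      hx (mem_inner.1 (verts_vb_subset_of_mem_kappa hG hp hv h)).2
    rw [mem_slide_of_ne (by rintro rfl; exact hxv (base_mem_verts G (.vb x B)))
      (by rintro rfl; exact hx (base_mem_verts G (.bv B x))), hag₁ x hxv]
  · by_cases hvv : v' = v
    · subst hvv
      exact hw₁
    · refine WeightLE.of_agree (vb_mem_arcs_of_mem_kappa hG hp hv') fun x hx => hag₁ x ?_
      exact Finset.disjoint_left.1 (verts_vb_disjoint hG hB ((mem_kappa hG hp).1 hv').1 hvB hvv)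
        (mem_inner.1 hx).2

/-- All blocks but one are cleared and a token is drawn from the remaining one. Once `u` is occupied
nothing blocks it, so the weight at `(u, B)` attains its linear value. -/
theorem canPull_vb (hC : G.IsIndepSet (C : Set V)) (hp : Arc.vb u B ∈ arcs G)
    (ih : ∀ B' ∈ beta G u B, CanPull hG C (.bv B' u)) : CanPull hG C (.vb u B) := by
  rintro D hopt ⟨E, hE, hlt⟩ huD hout
  have huD : u ∉ D := huD
  have hout : ∀ y ∈ D, G.Adj u y → y ∈ inner G (.vb u B) := hout
  have hD := hopt.1.isIndepSet hC
  have hu := (mem_arcs_vb.1 hp).1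
  have harc : ∀ B' ∈ beta G u B, Arc.bv B' u ∈ arcs G := fun B' hB' =>
    bv_mem_arcs_of_mem_beta hG hp hB'
  have hat : ∀ B' ∈ beta G u B, B' ∈ blocksAt G Finset.univ u := fun B' hB' =>
    ((mem_beta hG hp).1 hB').1
  have hsat : ∀ B' ∈ beta G u B, capAt hG (.bv B' u) D = 0 → ua hG (.bv B' u) →
      Saturated hG D B' u := by
    intro B' hB' h0 hua
    refine ⟨hua, fun F hF => ?_⟩
    have := ((hopt.vb_child hB').2 F (hopt.1.trans hF)).self
    rw [weight, weight, h0, zero_add] at this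
    exact this
  -- In an optimal set a blocking block is saturated. Two of them would freeze `u` and fix the inner
  -- count, against the existence of `E`.
  have hone : ∀ B₁ ∈ beta G u B, ∀ B₂ ∈ beta G u B, capAt hG (.bv B₁ u) D = 0 →
      ua hG (.bv B₁ u) → capAt hG (.bv B₂ u) D = 0 → ua hG (.bv B₂ u) → B₁ = B₂ := by
    intro B₁ h₁ B₂ h₂ h01 hua₁ h02 hua₂
    by_contra hne
    have hfr : Frozen hG D u := ⟨B₁, hat B₁ h₁, B₂, hat B₂ h₂, hne, hsat B₁ h₁ h01 hua₁,
      hsat B₂ h₂ h02 hua₂⟩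
    exact hlt.ne (hfr.innerCount_eq hu hD rfl (hopt.1.symm.trans hE))
  -- The token must come from the blocking block if there is one, since that block cannot be
  -- cleared; it has a token next to `u`. Otherwise any block with fewer tokens in `E` will do.
  obtain ⟨B₁, hB₁, hcase, hun⟩ : ∃ B₁ ∈ beta G u B,
      ((capAt hG (.bv B₁ u) D = 0 ∧ ua hG (.bv B₁ u)) ∨
        innerCount G (.bv B₁ u) E < innerCount G (.bv B₁ u) D) ∧
      ∀ B' ∈ beta G u B, B' ≠ B₁ → uaInt hG (.bv B' u) ≤ capAt hG (.bv B' u) D := by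
    by_cases hb : ∃ B₁ ∈ beta G u B, capAt hG (.bv B₁ u) D = 0 ∧ ua hG (.bv B₁ u)
    · obtain ⟨B₁, hB₁, h0, hua⟩ := hb
      exact ⟨B₁, hB₁, Or.inl ⟨h0, hua⟩, fun B' hB' hne =>
        uaInt_le_capAt_of_not_blocked hG hD (harc B' hB') fun h =>
          hne (hone B' hB' B₁ hB₁ h.1 h.2 h0 hua)⟩
    · push Not at hb
      rw [innerCount_vb hG hp, innerCount_vb hG hp] at hlt
      obtain ⟨B₁, hB₁, h⟩ := Finset.exists_lt_of_sum_lt hlt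
      exact ⟨B₁, hB₁, Or.inr h, fun B' hB' _ =>
        uaInt_le_capAt_of_not_blocked hG hD (harc B' hB') fun h => hb B' hB' h.1 h.2⟩
  have herase : ∀ B' ∈ (beta G u B).erase B₁, B' ≠ B₁ ∧ B' ∈ beta G u B := fun B' hB' =>
    Finset.mem_erase.1 hB'
  obtain ⟨D₁, hr₁, hag₁, hF₁⟩ := exists_clear_family hG hu ((beta G u B).erase B₁)
    (fun B' hB' => hat B' (herase B' hB').2)
    (fun B' hB' => (canClear_and_canPush hG _ (harc B' (herase B' hB').2)).1) hD
    (fun B' hB' => hun B' (herase B' hB').2 (herase B' hB').1)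
  have hin₁ : ∀ x ∈ inner G (.bv B₁ u), x ∈ D₁ ↔ x ∈ D := fun x hx =>
    hag₁ x fun B' hB' => Finset.disjoint_right.1 (disjoint_inner_bv_of_ne hG
      (hat B' (herase B' hB').2) (hat B₁ hB₁) (herase B' hB').1) hx
  have hout₁ : ∀ y ∈ D₁, G.Adj u y → y ∈ inner G (.bv B₁ u) := by
    intro y hy hadj
    by_contra hyB₁
    have hyB : ∀ B' ∈ beta G u B, y ∉ inner G (.bv B' u) := by
      intro B' hB' hyB'
      by_cases hne : B' = B₁
      · exact hyB₁ (hne ▸ hyB')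
      · exact (hF₁ B' (Finset.mem_erase.2 ⟨hne, hB'⟩)).2.2 y hyB' hadj hy
    have hyD := (hag₁ y fun B' hB' => hyB B' (herase B' hB').2).1 hy
    obtain ⟨B', hB', hyB'⟩ := exists_mem_inner_bv_of_mem_inner_vb hG hp (hout y hyD hadj)
    exact hyB B' hB' hyB'
  have huD₁ : u ∉ D₁ := fun h =>
    huD ((hag₁ u fun B' _ => base_notMem_inner (Arc.bv B' u)).1 h)
  have hw₁ : WeightLE hG (.bv B₁ u) D D₁ := WeightLE.of_agree (harc B₁ hB₁) hin₁
  obtain ⟨D₂, hr₂, huD₂, hag₂, hw₂⟩ : ∃ D₂, Reach G D₁ D₂ ∧ u ∈ D₂ ∧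
      (∀ x ∉ verts G (.bv B₁ u), x ∈ D₂ ↔ x ∈ D₁) ∧ WeightLE hG (.bv B₁ u) D₁ D₂ := by
    rcases hcase with ⟨h0, hua⟩ | hlt'
    · obtain ⟨w, hw, hwD⟩ := exists_mem_block_of_blocked hG hD (harc B₁ hB₁) h0 hua
      obtain ⟨-, hblock, hu₁⟩ := mem_arcs_bv.1 (harc B₁ hB₁)
      have hwin := block_sdiff_subset_inner_bv hG hblock hu₁ hw
      obtain ⟨hst, hle⟩ := step_slide_to_base (hG := hG) (harc B₁ hB₁) (hr₁.isIndepSet hD) hw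
        ((hin₁ w hwin).2 hwD) hout₁
      refine ⟨slide D₁ w u, .single hst, mem_slide.2 (Or.inl rfl), fun x hx => ?_, hle⟩
      refine mem_slide_of_ne ?_ ?_
      · rintro rfl
        exact hx (mem_inner.1 hwin).2
      · rintro rfl
        exact hx (base_mem_verts G (.bv B₁ x))
    · refine ih B₁ hB₁ D₁ ((hopt.vb_child hB₁).of_weightLE hr₁ hw₁) ⟨E, hE, ?_⟩ huD₁ hout₁
      rwa [innerCount_congr hin₁]
  have hle : ∀ B' ∈ beta G u B, WeightLE hG (.bv B' u) D D₂ := by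
    intro B' hB'
    by_cases hne : B' = B₁
    · subst hne
      exact hw₁.trans hw₂
    · refine (hF₁ B' (Finset.mem_erase.2 ⟨hne, hB'⟩)).1.trans
        (WeightLE.of_agree (harc B' hB') fun x hx => hag₂ x fun h => ?_)
      exact Finset.disjoint_left.1 (disjoint_inner_bv_of_ne hG (hat B' hB') (hat B₁ hB₁) hne) hx
        (mem_inner.2 ⟨(mem_inner.1 hx).1, h⟩)
  refine ⟨D₂, hr₁.trans hr₂, huD₂, fun x hx => ?_, WeightLE.vb hle ?_⟩
  · have hxB : ∀ B' ∈ beta G u B, x ∉ inner G (.bv B' u) := fun B' hB' h =>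
      hx (mem_inner.1 (inner_bv_subset_of_mem_beta hG hp hB' h)).2
    rw [hag₂ x, hag₁ x fun B' hB' => hxB B' (herase B' hB').2]
    intro h
    rcases mem_verts_iff.1 h with h | h
    · exact hx (h ▸ base_mem_verts G (.vb u B))
    · exact hxB B₁ hB₁ h
  · rw [weight_vb_of_unblocked hG hp fun B' hB' =>
      uaInt_le_capAt hG (Reach.isIndepSet (hr₁.trans hr₂) hD) (harc B' hB') huD₂]
    exact weight_vb_le_linearWeight hp hD (fun B' hB' => (hle B' hB').self)
      fun B₁ h₁ B₂ h₂ hT₁ hT₂ => hone B₁ h₁ B₂ h₂ hT₁.1 hT₁.2.1 hT₂.1 hT₂.2.1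

theorem canPull (hG : IsConnectedBlockGraph G) (hC : G.IsIndepSet (C : Set V)) :
    ∀ p ∈ arcs G, CanPull hG C p :=
  arc_induction hG (fun _ _ hp ih => canPull_bv hC hp ih) fun _ _ hp ih => canPull_vb hC hp ih

/-! ### Following a sequence of slides with optimal sets -/

/-- A sequence of slides from an optimal set can be followed by optimal sets that agree with it
outside `G[p]`. -/
theorem Optimal.simulate (hC : G.IsIndepSet (C : Set V)) (hp : p ∈ arcs G)
    (h : Optimal hG C p D) (hE : Reach G D E) :
    ∃ D', Optimal hG C p D' ∧ ∀ x ∉ inner G p, x ∈ D' ↔ x ∈ E := by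
  induction hE with
  | refl => exact ⟨D, h, fun _ _ => Iff.rfl⟩
  | @tail E E' hr hst ih =>
    obtain ⟨D', hopt, hag⟩ := ih
    have hCE : Reach G C E := h.1.trans hr
    have hCE' := hCE.tail hst
    have hE := hCE.isIndepSet hC
    have hE' := hst.2.1
    have hD' := hopt.1.isIndepSet hC
    have hcount : innerCount G p D' = innerCount G p E :=
      innerCount_eq_of_reach (hCE.symm.trans hopt.1) hag
    have hwle := (hopt.2 E' hCE').self
    rw [weight, weight] at hwle
    rcases hst.cases_slide with rfl | ⟨a, b, ha, hb, hab, rfl⟩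
    · exact ⟨D', hopt, hag⟩
    have haE' : a ∉ slide E a b := by simp [mem_slide, hab.ne]
    have hbE' : b ∈ slide E a b := mem_slide.2 (Or.inl rfl)
    by_cases hain : a ∈ inner G p <;> by_cases hbin : b ∈ inner G p
    · refine ⟨D', hopt, fun x hx => ?_⟩
      rw [mem_slide_of_ne (by rintro rfl; exact hx hain) (by rintro rfl; exact hx hbin), hag x hx]
    · have hbp : b = p.base := by
        by_contra hbp
        exact hbin (mem_inner_of_mem_inner_adj hain hab hbp)
      subst hbp
      have hc := innerCount_eq_add_one_of_reach (p := p) (D := slide E a p.base) (E := E)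
        (Relation.ReflTransGen.single hst.symm) hbE' hb fun x hx => by
          rw [mem_slide_of_ne]
          · rintro rfl
            exact hx (mem_inner.1 hain).2
          · rintro rfl
            exact hx (base_mem_verts G p)
      -- A token leaves the interior through the base. The set after the slide has one inner token
      -- fewer, which is the witness that a pull requires.
      obtain ⟨D'', hr'', hbD'', hag'', hw''⟩ := canPull hG hC p hp D' hopt ⟨_, hCE', by omega⟩
        (fun h => hb ((hag _ hbin).1 h)) (by
          intro y hy hadj
          by_contra hyin
          have hyE := (hag y hyin).1 hy
          have hya : y ≠ a := by rintro rfl; exact hyin hain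
          exact hE' hbE' (mem_slide.2 (Or.inr ⟨hya, hyE⟩)) hadj.ne hadj)
      refine ⟨D'', hopt.of_weightLE hr'' hw'', fun x hx => ?_⟩
      by_cases hxb : x = p.base
      · subst hxb
        exact iff_of_true hbD'' hbE'
      · rw [hag'' x fun hxv => hx (mem_inner.2 ⟨hxb, hxv⟩), hag x hx,
          mem_slide_of_ne (by rintro rfl; exact hx hain) hxb]
    · have hap : a = p.base := by
        by_contra hap
        exact hain (mem_inner_of_mem_inner_adj hbin hab.symm hap)
      subst hap
      have hc := innerCount_eq_add_one_of_reach (p := p) (.single hst) ha haE' fun x hx => by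
          rw [mem_slide_of_ne]
          · rintro rfl
            exact hx (base_mem_verts G p)
          · rintro rfl
            exact hx (mem_inner.1 hbin).2
      have hcap := capAt_nonneg hG hE' hp
      -- A token enters from the base. The optimal set has at least the weight of the set after the
      -- slide but one inner token fewer, so its capacity is positive.
      obtain ⟨D'', hr'', hbD'', hag'', hw''⟩ := (canClear_and_canPush hG p hp).2 D' hD'
        ((hag _ hain).2 ha) (by omega)
      refine ⟨D'', hopt.of_weightLE hr'' hw'', fun x hx => ?_⟩
      by_cases hxa : x = p.base
      · subst hxa
        exact iff_of_false hbD'' haE'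
      · rw [hag'' x fun hxv => hx (mem_inner.2 ⟨hxa, hxv⟩), hag x hx,
          mem_slide_of_ne hxa (by rintro rfl; exact hx hbin)]
    · have hc : innerCount G p (slide E a b) = innerCount G p E := innerCount_congr fun x hx =>
        mem_slide_of_ne (by rintro rfl; exact hain hx) (by rintro rfl; exact hbin hx)
      obtain ⟨D₁, hopt₁, hag₁, hc₁⟩ : ∃ D₁, Optimal hG C p D₁ ∧
          (∀ x ∉ inner G p, x ∈ D₁ ↔ x ∈ E) ∧ ∀ y ∈ inner G p, G.Adj b y → y ∉ D₁ := by
        by_cases hbp : b = p.base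
        · subst hbp
          -- The token arrives at the base from outside. The occupied base gives the followed set
          -- capacity at least `ua`; equal inner counts and optimality pass this on to `D'`, so the
          -- base can be cleared before the slide is copied.
          have hcap := uaInt_le_capAt hG hE' hp hbE'
          obtain ⟨D₁, hr₁, hag₁, hw₁, hc₁⟩ := (canClear_and_canPush hG p hp).1 D' hD' (by omega)
          exact ⟨D₁, hopt.of_weightLE hr₁ hw₁, fun x hx => (hag₁ x hx).trans (hag x hx), hc₁⟩
        · exact ⟨D', hopt, hag, fun y hy hadj =>
            absurd (mem_inner_of_mem_inner_adj hy hadj.symm hbp) hbin⟩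
      have hst₁ : Step G D₁ (slide D₁ a b) := by
        refine step_slide (hopt₁.1.isIndepSet hC) ((hag₁ a hain).2 ha) hab ?_
        intro y hy hadj
        by_contra hya
        by_cases hyin : y ∈ inner G p
        · exact hc₁ y hyin hadj hy
        · exact hE' hbE' (mem_slide.2 (Or.inr ⟨hya, (hag₁ y hyin).1 hy⟩)) hadj.ne hadj
      refine ⟨slide D₁ a b, hopt₁.of_weightLE (.single hst₁) (WeightLE.of_agree hp fun x hx =>
        mem_slide_of_ne (by rintro rfl; exact hain hx) (by rintro rfl; exact hbin hx)),
        fun x hx => ?_⟩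
      rw [mem_slide, mem_slide, hag₁ x hx]

/-- Optimal sets for parts with disjoint interiors can be combined. -/
theorem exists_optimal_family {ι : Type*} [DecidableEq ι] (hC : G.IsIndepSet (C : Set V))
    (s : Finset ι) (f : ι → Arc V) (hf : ∀ i ∈ s, f i ∈ arcs G)
    (hdisj : ∀ i ∈ s, ∀ j ∈ s, i ≠ j → Disjoint (inner G (f i)) (inner G (f j)))
    (hex : ∀ i ∈ s, ∃ D, Optimal hG C (f i) D) (hE : Reach G C E) :
    ∃ D, Reach G C D ∧ (∀ i ∈ s, Optimal hG C (f i) D) ∧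
      ∀ x, (∀ i ∈ s, x ∉ inner G (f i)) → (x ∈ D ↔ x ∈ E) := by
  induction s using Finset.induction_on with
  | empty => exact ⟨E, hE, by simp, fun _ _ => Iff.rfl⟩
  | insert i₀ s hi₀ ih =>
    obtain ⟨D₁, hr₁, hopt₁, hag₁⟩ := ih (fun i hi => hf i (Finset.mem_insert_of_mem hi))
      (fun i hi j hj => hdisj i (Finset.mem_insert_of_mem hi) j (Finset.mem_insert_of_mem hj))
      (fun i hi => hex i (Finset.mem_insert_of_mem hi))
    have h₀ := Finset.mem_insert_self i₀ s
    obtain ⟨D₀, hopt₀⟩ := hex i₀ h₀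
    -- Slides are reversible, so the set optimal for the new part can follow a route via `C` to the
    -- set that is optimal for the earlier parts.
    obtain ⟨D, hopt, hag⟩ := hopt₀.simulate hC (hf i₀ h₀) (hopt₀.1.symm.trans hr₁)
    refine ⟨D, hopt.1, fun i hi => ?_, fun x hx => ?_⟩
    · rcases Finset.mem_insert.1 hi with rfl | his
      · exact hopt
      · refine (hopt₁ i his).of_weightLE (hr₁.symm.trans hopt.1) (WeightLE.of_agree (hf i hi)
          fun x hx => hag x ?_)
        exact Finset.disjoint_left.1 (hdisj i hi i₀ h₀ (by rintro rfl; exact hi₀ his)) hx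
    · rw [hag x (hx i₀ h₀), hag₁ x fun i hi => hx i (Finset.mem_insert_of_mem hi)]

/-- Two blocking blocks of `E` that already have maximal weight would be saturated at `E`. They
would freeze `u`, keep all inner counts at `u` constant, and hence be saturated at `C` too. -/
theorem weight_vb_le_linearWeight_of_not_frozen (hC : G.IsIndepSet (C : Set V))
    (hp : Arc.vb u B ∈ arcs G) (hfr : ¬ Frozen hG C u)
    (hopt : ∀ B' ∈ beta G u B, Optimal hG C (.bv B' u) D) (hE : Reach G C E) :
    weight hG (.vb u B) E ≤ linearWeight hG u B D := by
  have hEi := hE.isIndepSet hC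
  refine weight_vb_le_linearWeight hp hEi (fun B' hB' => ((hopt B' hB').2 E hE).self) ?_
  rintro B₁ h₁ B₂ h₂ ⟨h01, hua₁, hw₁⟩ ⟨h02, hua₂, hw₂⟩
  by_contra hne
  have hsat : ∀ B' ∈ beta G u B, capAt hG (.bv B' u) E = 0 → ua hG (.bv B' u) →
      weight hG (.bv B' u) E = weight hG (.bv B' u) D → Saturated hG E B' u := by
    intro B' hB' h0 hua hw
    refine ⟨hua, fun F hF => ?_⟩
    have := ((hopt B' hB').2 F (hE.trans hF)).self
    rw [← hw] at this
    rw [weight, weight, h0, zero_add] at this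
    exact this
  have hat : ∀ B' ∈ beta G u B, B' ∈ blocksAt G Finset.univ u := fun B' hB' =>
    ((mem_beta hG hp).1 hB').1
  have hs₁ := hsat B₁ h₁ h01 hua₁ hw₁
  have hs₂ := hsat B₂ h₂ h02 hua₂ hw₂
  have hfrE : Frozen hG E u := ⟨B₁, hat B₁ h₁, B₂, hat B₂ h₂, hne, hs₁, hs₂⟩
  have hcount : ∀ B', innerCount G (.bv B' u) E = innerCount G (.bv B' u) C := fun B' =>
    (hfrE.innerCount_eq (mem_arcs_vb.1 hp).1 hEi rfl hE.symm).symm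
  exact hfr ⟨B₁, hat B₁ h₁, B₂, hat B₂ h₂, hne, hs₁.of_reach hE (hcount B₁),
    hs₂.of_reach hE (hcount B₂)⟩

/-- Unless `u` is frozen, some reachable set that is optimal for the blocks of `β(u, B)` leaves `u`
unblocked. -/
theorem exists_optimal_unblocked (hC : G.IsIndepSet (C : Set V))
    (hp : Arc.vb u B ∈ arcs G) (hfr : ¬ Frozen hG C u)
    (hex : ∀ B' ∈ beta G u B, ∃ D, Optimal hG C (.bv B' u) D) :
    ∃ D, Reach G C D ∧ (∀ B' ∈ beta G u B, Optimal hG C (.bv B' u) D) ∧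
      ∀ B' ∈ beta G u B, uaInt hG (.bv B' u) ≤ capAt hG (.bv B' u) D := by
  obtain ⟨hu, hB, huB⟩ := mem_arcs_vb.1 hp
  have harc : ∀ B' ∈ blocksAt G Finset.univ u, Arc.bv B' u ∈ arcs G := fun B' hB' =>
    mem_arcs_bv.2 ⟨hu, mem_blocksAt.1 hB'⟩
  have hat : ∀ B' ∈ beta G u B, B' ∈ blocksAt G Finset.univ u := fun B' hB' =>
    ((mem_beta hG hp).1 hB').1
  have hcomb : ∀ E, Reach G C E → ∃ D, Reach G C D ∧
      (∀ B' ∈ beta G u B, Optimal hG C (.bv B' u) D) ∧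
      ∀ x, (∀ B' ∈ beta G u B, x ∉ inner G (.bv B' u)) → (x ∈ D ↔ x ∈ E) := fun E hE =>
    exists_optimal_family hC (beta G u B) (fun B' => .bv B' u) (fun B' hB' => harc B' (hat B' hB'))
      (fun B₁ h₁ B₂ h₂ hne => disjoint_inner_bv_of_ne hG (hat B₁ h₁) (hat B₂ h₂) hne) hex hE
  by_cases hocc : ∃ E, Reach G C E ∧ u ∈ E
  · obtain ⟨E, hE, huE⟩ := hocc
    obtain ⟨D, hr, hopt, hag⟩ := hcomb E hE
    have huD : u ∈ D := (hag u fun B' _ => base_notMem_inner (Arc.bv B' u)).2 huE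
    exact ⟨D, hr, hopt, fun B' hB' =>
      uaInt_le_capAt hG (hr.isIndepSet hC) (harc B' (hat B' hB')) huD⟩
  have hnever : ∀ E, Reach G C E → u ∉ E := fun E hE huE => hocc ⟨E, hE, huE⟩
  have hcount : ∀ B' E, Reach G C E → innerCount G (.bv B' u) E = innerCount G (.bv B' u) C :=
    fun B' E hE => innerCount_eq_of_base_never_mem (p := .bv B' u) hnever hE
  obtain ⟨D₀, hr₀, hopt₀, -⟩ := hcomb C .refl
  -- Here `u` is never occupied and all inner counts at `u` are constant. Were every combined
  -- optimum blocked, a token could nevertheless be brought to `u`.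
  by_contra hcon
  obtain ⟨B₁, hB₁, h0, hua₁⟩ : ∃ B₁ ∈ beta G u B,
      capAt hG (.bv B₁ u) D₀ = 0 ∧ ua hG (.bv B₁ u) := by
    by_contra hb
    push Not at hb
    exact hcon ⟨D₀, hr₀, hopt₀, fun B' hB' => uaInt_le_capAt_of_not_blocked hG
      (hr₀.isIndepSet hC) (harc B' (hat B' hB')) fun h => hb B' hB' h.1 h.2⟩
  have hs₁ : Saturated hG C B₁ u := by
    refine ⟨hua₁, fun E hE => ?_⟩
    have := ((hopt₀ B₁ hB₁).2 E hE).self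
    rw [weight, weight, h0, zero_add, hcount B₁ D₀ hr₀] at this
    exact this
  -- A second block without room in any reachable set would be saturated as well, and `u` would be
  -- frozen.
  have hroom : ∀ B₂ ∈ blocksAt G Finset.univ u, B₂ ≠ B₁ →
      ∃ E, Reach G C E ∧ uaInt hG (.bv B₂ u) ≤ capAt hG (.bv B₂ u) E := by
    intro B₂ hB₂ hne
    by_cases hua₂ : ua hG (.bv B₂ u)
    · by_contra! hno
      refine hfr ⟨B₁, hat B₁ hB₁, B₂, hB₂, hne.symm, hs₁, hua₂, fun E hE => ?_⟩
      have h1 := hno E hE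
      have h2 := hcount B₂ E hE
      rw [uaInt_of_ua hua₂] at h1
      rw [weight]
      omega
    · exact ⟨C, .refl, by rw [uaInt_of_not_ua hua₂]; exact capAt_nonneg hG hC (harc B₂ hB₂)⟩
  have hBat : B ∈ blocksAt G Finset.univ u := mem_blocksAt.2 ⟨hB, huB⟩
  obtain ⟨E, hE, hcapE⟩ := hroom B hBat ((mem_beta hG hp).1 hB₁).2.symm
  -- One set with room in all blocks but `B₁`: in `B` it agrees with `E`, and in the other blocks
  -- optimality with constant inner counts turns larger weight into larger capacity.
  obtain ⟨D₁, hr₁, hopt₁, hag₁⟩ := hcomb E hE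
  have hD₁ := hr₁.isIndepSet hC
  have hcap₁ : ∀ B₂ ∈ (blocksAt G Finset.univ u).erase B₁,
      uaInt hG (.bv B₂ u) ≤ capAt hG (.bv B₂ u) D₁ := by
    intro B₂ hB₂
    obtain ⟨hne, hB₂⟩ := Finset.mem_erase.1 hB₂
    by_cases hBB : B₂ = B
    · subst hBB
      rwa [capAt_congr hG (harc B₂ hB₂) fun x hx => hag₁ x fun B' hB' =>
        Finset.disjoint_right.1 (disjoint_inner_bv_of_ne hG (hat B' hB') hB₂
          ((mem_beta hG hp).1 hB').2) hx]
    · obtain ⟨F, hF, hcapF⟩ := hroom B₂ hB₂ hne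
      have h1 := ((hopt₁ B₂ ((mem_beta hG hp).2 ⟨hB₂, hBB⟩)).2 F hF).self
      have h2 := hcount B₂ F hF
      have h3 := hcount B₂ D₁ hr₁
      rw [weight, weight] at h1
      omega
  have h01 := hs₁.capAt_eq_zero hC (harc B₁ (hat B₁ hB₁)) hr₁ (hcount B₁ D₁ hr₁)
  obtain ⟨w, hw, hwD₁⟩ := exists_mem_block_of_blocked hG hD₁ (harc B₁ (hat B₁ hB₁)) h01 hua₁
  obtain ⟨D₂, hr₂, hag₂, hF₂⟩ := exists_clear_family hG hu ((blocksAt G Finset.univ u).erase B₁)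
    (Finset.erase_subset _ _)
    (fun B' hB' => (canClear_and_canPush hG _ (harc B' (Finset.mem_of_mem_erase hB'))).1) hD₁ hcap₁
  obtain ⟨hblock, hu₁⟩ := mem_blocksAt.1 (hat B₁ hB₁)
  have hwD₂ : w ∈ D₂ := by
    refine (hag₂ w fun B' hB' => ?_).2 hwD₁
    exact Finset.disjoint_right.1 (disjoint_inner_bv_of_ne hG (Finset.mem_of_mem_erase hB')
      (hat B₁ hB₁) (Finset.ne_of_mem_erase hB')) (block_sdiff_subset_inner_bv hG hblock hu₁ hw)
  -- All blocks other than `B₁`, including `B`, are now clear around `u`, so the token on `w` can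
  -- slide to `u`, which is the contradiction.
  have hst := (step_slide_to_base (hG := hG) (harc B₁ (hat B₁ hB₁)) (hr₂.isIndepSet hD₁) hw hwD₂ (by
    intro y hy hadj
    obtain ⟨B', hB', huB', hyB'⟩ := exists_block_of_adj hadj
    have hyin := mem_inner_bv_of_adj hadj hyB'
    by_cases hne : B' = B₁
    · exact hne ▸ hyin
    · exact absurd hy ((hF₂ B' (Finset.mem_erase.2 ⟨hne, mem_blocksAt.2 ⟨hB', huB'⟩⟩)).2.2 y
        hyin hadj))).1
  exact hnever _ ((hr₁.trans hr₂).tail hst) (mem_slide.2 (Or.inl rfl))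

theorem exists_optimal (hG : IsConnectedBlockGraph G) (hC : G.IsIndepSet (C : Set V)) :
    ∀ p ∈ arcs G, ∃ D, Optimal hG C p D := by
  refine arc_induction hG ?_ ?_
  · intro B u hp ih
    obtain ⟨D, hr, hopt, -⟩ := exists_optimal_family hC (kappa G B u) (fun v => .vb v B)
      (fun v hv => vb_mem_arcs_of_mem_kappa hG hp hv)
      (fun v hv w hw hne => disjoint_inner_vb_of_ne hG hp ((mem_kappa hG hp).1 hv).1
        ((mem_kappa hG hp).1 hw).1 hne) ih .refl
    exact ⟨D, hr, fun E hE => WeightLE.bv hp fun v hv => (hopt v hv).2 E hE⟩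
  · intro u B hp ih
    by_cases hfr : Frozen hG C u
    · obtain ⟨D, hr, hopt, -⟩ := exists_optimal_family hC (beta G u B) (fun B' => .bv B' u)
        (fun B' hB' => bv_mem_arcs_of_mem_beta hG hp hB')
        (fun B₁ h₁ B₂ h₂ hne => disjoint_inner_bv_of_ne hG ((mem_beta hG hp).1 h₁).1
          ((mem_beta hG hp).1 h₂).1 hne) ih .refl
      refine ⟨D, hr, fun E hE => WeightLE.vb (fun B' hB' => (hopt B' hB').2 E hE) ?_⟩
      rw [weight_vb_of_frozen hp hC hfr hE, weight_vb_of_frozen hp hC hfr hr]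
    · obtain ⟨D, hr, hopt, hun⟩ := exists_optimal_unblocked hC hp hfr ih
      refine ⟨D, hr, fun E hE => WeightLE.vb (fun B' hB' => (hopt B' hB').2 E hE) ?_⟩
      rw [weight_vb_of_unblocked hG hp hun]
      exact weight_vb_le_linearWeight_of_not_frozen hC hp hfr hopt hE

/-- The optimal set itself may be blocked; comparison with an unblocked set that is optimal at the
blocks still gives the linear value. -/
theorem Optimal.weight_vb (hC : G.IsIndepSet (C : Set V)) (hp : Arc.vb u B ∈ arcs G)
    (hfr : ¬ Frozen hG C u) (h : Optimal hG C (.vb u B) D) :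
    weight hG (.vb u B) D = linearWeight hG u B D := by
  refine (weight_vb_le_linearWeight_of_not_frozen hC hp hfr (fun B' hB' => h.vb_child hB')
    h.1).antisymm ?_
  obtain ⟨D', hr, hopt, hun⟩ := exists_optimal_unblocked hC hp hfr fun B' hB' =>
    ⟨D, h.vb_child hB'⟩
  refine le_trans ?_ (h.2 D' hr).self
  rw [weight_vb_of_unblocked hG hp hun]
  exact linearWeight_le fun B' hB' => ((hopt B' hB').2 D h.1).self

/-! ### The potential -/

theorem Optimal.pot_eq (hC : G.IsIndepSet (C : Set V)) (h : Optimal hG C p D) :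
    pot hG C p = weight hG p D - innerCount G p C := by
  refine (pot_isGreatest hG hC p).unique ⟨⟨D, ⟨hC, h.1.isIndepSet hC, h.1⟩, ?_⟩, ?_⟩
  · rw [interiorOf_restrict, interiorOf_restrict]
    rfl
  · rintro x ⟨E, ⟨-, -, hE⟩, rfl⟩
    rw [interiorOf_restrict, interiorOf_restrict]
    exact sub_le_sub_right (h.2 E hE).self _

/-- The potential at an arc is non-negative, because `C` is reachable from itself and has
non-negative capacity. The upper bound in saturation thus amounts to its vanishing. -/
theorem saturated_iff (hC : G.IsIndepSet (C : Set V)) (hp : Arc.bv B u ∈ arcs G) :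
    Saturated hG C B u ↔ pot hG C (.bv B u) = 0 ∧ ua hG (.bv B u) := by
  obtain ⟨D, hD⟩ := exists_optimal hG hC _ hp
  rw [hD.pot_eq hC]
  constructor
  · rintro ⟨hua, h⟩
    have h1 := h D hD.1
    have h2 := (hD.2 C .refl).self
    have h3 := capAt_nonneg hG hC hp
    have h4 : weight hG (.bv B u) C = capAt hG (.bv B u) C + innerCount G (.bv B u) C := rfl
    exact ⟨by omega, hua⟩
  · rintro ⟨h, hua⟩
    exact ⟨hua, fun E hE => by have := (hD.2 E hE).self; omega⟩

theorem frozen_iff (hC : G.IsIndepSet (C : Set V)) (hu : u ∈ cutVertices G Finset.univ) :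
    Frozen hG C u ↔ ∃ B' ∈ blocksAt G Finset.univ u, ∃ B'' ∈ blocksAt G Finset.univ u, B' ≠ B'' ∧
      pot hG C (.bv B' u) = 0 ∧ pot hG C (.bv B'' u) = 0 ∧
      ua hG (.bv B' u) ∧ ua hG (.bv B'' u) := by
  refine exists_congr fun B' => and_congr_right fun hB' => exists_congr fun B'' =>
    and_congr_right fun hB'' => and_congr_right fun _ => ?_
  rw [saturated_iff hC (show Arc.bv B' u ∈ arcs G from ⟨hu, hB'⟩),
    saturated_iff hC (show Arc.bv B'' u ∈ arcs G from ⟨hu, hB''⟩)]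
  tauto

theorem pot_bv (hC : G.IsIndepSet (C : Set V)) (hp : Arc.bv B u ∈ arcs G) :
    pot hG C (.bv B u) = (∑ u' ∈ kappa G B u, pot hG C (.vb u' B)) + uaInt hG (.bv B u) -
      ((B ∩ interiorOf (.bv B u) (restrict G C (.bv B u))).card : ℤ) := by
  obtain ⟨D, hD⟩ := exists_optimal hG hC _ hp
  obtain ⟨-, hB, hu⟩ := mem_arcs_bv.1 hp
  have h1 : ∑ u' ∈ kappa G B u, pot hG C (.vb u' B) =
      ∑ u' ∈ kappa G B u, (weight hG (.vb u' B) D - innerCount G (.vb u' B) C) :=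
    Finset.sum_congr rfl fun v hv => (hD.bv_child hv).pot_eq hC
  have h2 : B ∩ interiorOf (.bv B u) (restrict G C (.bv B u)) = B.erase u ∩ C := by
    rw [interiorOf_restrict, ← Finset.inter_assoc]
    congr 1
    ext x
    simp only [Finset.mem_inter, Finset.mem_erase]
    constructor
    · rintro ⟨hx, hx'⟩
      exact ⟨(mem_inner.1 hx').1, hx⟩
    · rintro ⟨hxu, hx⟩
      exact ⟨hx, block_sdiff_subset_inner_bv hG hB hu (Finset.mem_erase.2 ⟨hxu, hx⟩)⟩
  rw [h1, h2, hD.pot_eq hC, weight_bv hG hp, innerCount_bv hG hp, Finset.sum_sub_distrib]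
  ring

theorem pot_vb_of_frozen (hC : G.IsIndepSet (C : Set V)) (hp : Arc.vb u B ∈ arcs G)
    (hfr : Frozen hG C u) : pot hG C (.vb u B) = 0 := by
  obtain ⟨D, hD⟩ := exists_optimal hG hC _ hp
  rw [hD.pot_eq hC, weight_vb_of_frozen hp hC hfr hD.1, sub_self]

theorem pot_vb_of_not_frozen (hC : G.IsIndepSet (C : Set V)) (hp : Arc.vb u B ∈ arcs G)
    (hfr : ¬ Frozen hG C u) :
    pot hG C (.vb u B) = (∑ B' ∈ beta G u B, (pot hG C (.bv B' u) - uaInt hG (.bv B' u))) +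
      uaInt hG (.vb u B) := by
  obtain ⟨D, hD⟩ := exists_optimal hG hC _ hp
  have h1 : ∑ B' ∈ beta G u B, (pot hG C (.bv B' u) - uaInt hG (.bv B' u)) =
      ∑ B' ∈ beta G u B, (weight hG (.bv B' u) D - innerCount G (.bv B' u) C -
        uaInt hG (.bv B' u)) :=
    Finset.sum_congr rfl fun B' hB' => by rw [(hD.vb_child hB').pot_eq hC]
  rw [h1, hD.pot_eq hC, hD.weight_vb hC hp hfr, linearWeight, innerCount_vb hG hp]
  simp only [Finset.sum_sub_distrib]
  ring

theorem exists_reachable_pot_le_cap (hG : IsConnectedBlockGraph G) (hC : G.IsIndepSet (C : Set V))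
    (hp : p ∈ arcs G) : ∃ C' : Finset V, IsReachableFrom G C' C ∧
      pot hG C p ≤ cap hG p (restrict G C' p) ∧
      (interiorOf p (restrict G C' p)).card = (interiorOf p (restrict G C p)).card := by
  obtain ⟨D, hD⟩ := exists_optimal hG hC p hp
  -- Following the slides back to `C` gives an optimal set that agrees with `C` outside the
  -- interior, hence has the same inner count. Its capacity is then the whole potential.
  obtain ⟨D', hD', hag⟩ := hD.simulate hC hp hD.1.symm
  have hc := innerCount_eq_of_reach hD'.1 hag
  refine ⟨D', ⟨hC, hD'.1.isIndepSet hC, hD'.1⟩, ?_, ?_⟩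
  · rw [hD'.pot_eq hC, weight, hc, add_sub_cancel_right, capAt]
  · rw [interiorOf_restrict, interiorOf_restrict]
    rw [innerCount, innerCount] at hc
    exact_mod_cast hc

end Optimal

end TokenSliding

theorem mainTheorem4 {V : Type*} [Fintype V] [DecidableEq V] (G : SimpleGraph V)
    (hG : IsConnectedBlockGraph G) (C : Finset V) (hC : G.IsIndepSet (C : Set V)) :
    (∀ u B, u ∈ cutVertices G Finset.univ → B ∈ blocksAt G Finset.univ u →
      pot hG C (.bv B u) = (∑ u' ∈ kappa G B u, pot hG C (.vb u' B)) + uaInt hG (.bv B u) -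
        ((B ∩ interiorOf (.bv B u) (restrict G C (.bv B u))).card : ℤ)) ∧
    (∀ u B, u ∈ cutVertices G Finset.univ → B ∈ blocksAt G Finset.univ u →
      ((∃ B' ∈ blocksAt G Finset.univ u, ∃ B'' ∈ blocksAt G Finset.univ u, B' ≠ B'' ∧
          pot hG C (.bv B' u) = 0 ∧ pot hG C (.bv B'' u) = 0 ∧
          ua hG (.bv B' u) ∧ ua hG (.bv B'' u)) →
        pot hG C (.vb u B) = 0) ∧
      (¬ (∃ B' ∈ blocksAt G Finset.univ u, ∃ B'' ∈ blocksAt G Finset.univ u, B' ≠ B'' ∧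
          pot hG C (.bv B' u) = 0 ∧ pot hG C (.bv B'' u) = 0 ∧
          ua hG (.bv B' u) ∧ ua hG (.bv B'' u)) →
        pot hG C (.vb u B) =
          (∑ B' ∈ beta G u B, (pot hG C (.bv B' u) - uaInt hG (.bv B' u))) +
            uaInt hG (.vb u B))) ∧
    (∀ p ∈ arcs G, ∃ C' : Finset V, IsReachableFrom G C' C ∧
      pot hG C p ≤ cap hG p (restrict G C' p) ∧
      (interiorOf p (restrict G C' p)).card = (interiorOf p (restrict G C p)).card) := by
  refine ⟨fun u B hu hB => pot_bv hC ⟨hu, hB⟩, fun u B hu hB => ⟨fun h => ?_, fun h => ?_⟩,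
    fun p hp => exists_reachable_pot_le_cap hG hC hp⟩
  · exact pot_vb_of_frozen hC ⟨hu, hB⟩ ((frozen_iff hC hu).2 h)
  · exact pot_vb_of_not_frozen hC ⟨hu, hB⟩ (mt (frozen_iff hC hu).1 h)
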